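/- **Setting.** Let $\mathcal H$ be a complex Hilbert space, $D$ a (possibly unbounded) self-adjoint operator in $\mathcal H$, and $\mathcal A$ a commutative unital $*$-algebra of bounded operators on $\mathcal H$ (with $1_{\mathcal A}=\mathrm{id}_{\mathcal H}$) such that every $a\in\mathcal A$ preserves $\mathrm{Dom}\,D$ and $[D,a]$ extends to a bounded operator, still denoted $[D,a]$. Let $\delta(T)=[|D|,T]$, with domain the bounded operators $T$ such that $T\,\mathrm{Dom}|D|\subset \mathrm{Dom}|D|$ and $[|D|,T]$ is bounded. Assume * (regularity) for all $a\in\mathcal A$ and $m\in\mathbb N$, both $a$ and $[D,a]$ belong to $\mathrm{Dom}\,\delta^m$; * (order one) $[[D,f],g]=0$ for all $f,g\in\mathcal A$. Let $X=\mathrm{Spec}(\mathcal A)$ be the space of continuous characters of $\mathcal A$ (for the operator norm) with the weak-$*$ topology, i.e. the Gelfand spectrum of the norm closure of $\mathcal A$; the support of $b\in\mathcal A$ is the closure of $\{\varphi\in X:\varphi(b)\neq0\}$. **Theorem 5.1.** (1) Let $h=h^*\in\mathcal A$ and let $\chi\in X$ be a point where $|\chi(h)|=\max_{\varphi\in X}|\varphi(h)|$.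 Let $(b_n)$ be a sequence in $\mathcal A$ with $\sup_n\|b_n\|<\infty$ whose supports tend to $\{\chi\}$, i.e. for every neighbourhood $U$ of $\chi$ the support of $b_n$ is contained in $U$ for all large $n$. Then $$\|[D,h]\,b_n\|\longrightarrow 0 .$$ (2) (Corollary 5.2) Suppose moreover that $\mathcal H_\infty=\bigcap_m \mathrm{Dom}\,D^m$ is a finite projective Hermitian $\mathcal A$-module, absolutely continuous with respect to a linear functional on $\mathcal A$: that is, $\mathcal H_\infty$ is stable under $\mathcal A$, there are $n\in\mathbb N$, an idempotent $e=e^*\in M_n(\mathcal A)$ and an isomorphism of $\mathcal A$-modules $\mathcal H_\infty\cong e\mathcal A^n$, and there is a linear functional $\lambda:\mathcal A\to\mathbb C$ such that, with $(\xi|\eta)=\sum_i\xi_i^*\eta_i\in\mathcal A$, $$\langle\xi,a\eta\rangle=\lambda\big(a\,(\xi|\eta)\big)\qquad \forall a\in\mathcal A,\ \xi,\eta\in\mathcal H_\infty .$$ (For instance, $\lambda(a)=\mathrm{Tr}_\omega(a|D|^{-p})$ given by a Dixmier trace.) Then for every $\xi\in\mathcal H_\infty$ one has $[D,a]\xi\in\mathcal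 H_\infty$ for all $a\in\mathcal A$, the map $\delta_\xi(a)=i\,(\xi|[D,a]\xi)$ is a derivation of $\mathcal A$, and $\pm\delta_\xi$ are dissipative: $$\|x+t\,\delta_\xi(x)\|\ \ge\ \|x\|\qquad\forall x\in\mathcal A,\ t\in\mathbb R .$$ -/

import Mathlib

noncomputable section

namespace ConnesSpectral

variable {H : Type*} [NormedAddCommGroup H] [InnerProductSpace ℂ H] [CompleteSpace H]

/-! ### The absolute value of an unbounded self-adjoint operator -/

/-- `P` is an absolute value of the unbounded operator `D`: it is self-adjoint, positive, and
`P² = D²` as unbounded operators (same domain `{x ∈ Dom P | P x ∈ Dom P}`, same values). For a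
self-adjoint `D` there is exactly one such `P`. -/
def IsAbs (D P : H →ₗ.[ℂ] H) : Prop :=
  IsSelfAdjoint P ∧
  (∀ x : P.domain, 0 ≤ (inner ℂ (P x) (x : H)).re) ∧
  ∀ x z : H, (∃ y, (x, y) ∈ P.graph ∧ (y, z) ∈ P.graph) ↔
    ∃ y, (x, y) ∈ D.graph ∧ (y, z) ∈ D.graph

theorem mem_graph_iff_of_selfAdjoint {D : H →ₗ.[ℂ] H} (hD : IsSelfAdjoint D) (x y : H) :
    (x, y) ∈ D.graph ↔ ∀ u v, (u, v) ∈ D.graph → inner ℂ v x = inner ℂ u y := by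
  have h1 := LinearPMap.adjoint_graph_eq_graph_adjoint hD.dense_domain
  rw [LinearPMap.isSelfAdjoint_def.mp hD] at h1
  conv_lhs => rw [h1]
  simp [Submodule.mem_adjoint_iff, sub_eq_zero]

/-- The bounded operator `(1 + D²)⁻¹` exists. -/
theorem exists_resolvent {D : H →ₗ.[ℂ] H} (hD : IsSelfAdjoint D) :
    ∃ R : H →L[ℂ] H, 0 ≤ R ∧ 0 ≤ 1 - R ∧
      ∀ x z : H, (∃ y, (x, y) ∈ D.graph ∧ (y, z) ∈ D.graph) ↔ ∃ w, x = R w ∧ z = w - R w := by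
  let G : Submodule ℂ (WithLp 2 (H × H)) :=
    D.graph.comap (WithLp.linearEquiv 2 ℂ (H × H)).toLinearMap
  have hGc : IsClosed (G : Set (WithLp 2 (H × H))) :=
    hD.isClosed.preimage (WithLp.prod_continuous_ofLp 2 H H)
  have : CompleteSpace G := hGc.completeSpace_coe
  let R : H →L[ℂ] H := (WithLp.fstL 2 ℂ H H).comp
    (G.starProjection.comp
      ((WithLp.prodContinuousLinearEquiv 2 ℂ H H).symm.toContinuousLinearMap.comp
        (ContinuousLinearMap.inl ℂ H H)))
  have hR : ∀ z, ∃ y, (R z, y) ∈ D.graph ∧ (y, z - R z) ∈ D.graph := by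
    intro z
    set p := G.starProjection (WithLp.toLp 2 (z, 0)) with hp
    have hRz : R z = p.fst := rfl
    have hpG : p ∈ G := G.starProjection_apply_mem _
    refine ⟨p.snd, ?_, ?_⟩
    · rw [hRz]; exact hpG
    · rw [mem_graph_iff_of_selfAdjoint hD]
      intro u v huv
      have h2 := G.starProjection_inner_eq_zero (WithLp.toLp 2 (z, 0)) (WithLp.toLp 2 (u, v)) huv
      rw [← hp, ← inner_conj_symm, map_eq_zero] at h2
      simp only [WithLp.prod_inner_apply] at h2
      have h3 : inner ℂ u (z - p.fst) + inner ℂ v (0 - p.snd) = (0 : ℂ) := h2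
      rw [zero_sub, inner_neg_right] at h3
      rw [hRz]
      exact (add_neg_eq_zero.mp h3).symm
  have hsym : ∀ a b c d : H, (a, b) ∈ D.graph → (c, d) ∈ D.graph →
      inner ℂ b c = inner ℂ a d := fun a b c d hab hcd =>
    (mem_graph_iff_of_selfAdjoint hD c d).mp hcd a b hab
  have hin : ∀ z y, (R z, y) ∈ D.graph → (y, z - R z) ∈ D.graph →
      inner ℂ y y = inner ℂ (R z) (z - R z) := fun z y h1 h2 => hsym _ _ _ _ h1 h2
  have hRpos : 0 ≤ R := by
    rw [ContinuousLinearMap.nonneg_iff_isPositive, ContinuousLinearMap.isPositive_iff_complex]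
    intro z
    obtain ⟨y, h1, h2⟩ := hR z
    have h3 : inner ℂ (R z) z = inner ℂ y y + inner ℂ (R z) (R z) := by
      rw [hin z y h1 h2, ← inner_add_right, sub_add_cancel]
    rw [h3, inner_self_eq_norm_sq_to_K, inner_self_eq_norm_sq_to_K]
    norm_cast
    exact ⟨rfl, by positivity⟩
  have hRpos' : 0 ≤ 1 - R := by
    rw [ContinuousLinearMap.nonneg_iff_isPositive, ContinuousLinearMap.isPositive_iff_complex]
    intro z
    obtain ⟨y, h1, h2⟩ := hR z
    have h4 : inner ℂ (z - R z) (R z) = inner ℂ y y := by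
      rw [← inner_conj_symm, ← hin z y h1 h2, inner_conj_symm]
    have h3 : inner ℂ ((1 - R) z) z = inner ℂ (z - R z) (z - R z) + inner ℂ y y := by
      rw [← h4, ← inner_add_right, sub_add_cancel]; rfl
    rw [h3, inner_self_eq_norm_sq_to_K, inner_self_eq_norm_sq_to_K]
    norm_cast
    exact ⟨rfl, by positivity⟩
  refine ⟨R, hRpos, hRpos', fun x z => ⟨?_, ?_⟩⟩
  · rintro ⟨y, h1, h2⟩
    obtain ⟨y', h1', h2'⟩ := hR (x + z)
    have ha : (x - R (x + z), y - y') ∈ D.graph := D.graph.sub_mem h1 h1'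
    have hb : (y - y', z - (x + z - R (x + z))) ∈ D.graph := D.graph.sub_mem h2 h2'
    have hc : z - (x + z - R (x + z)) = -(x - R (x + z)) := by abel
    rw [hc] at hb
    have hd := hsym _ _ _ _ ha hb
    rw [inner_neg_right, inner_self_eq_norm_sq_to_K, inner_self_eq_norm_sq_to_K] at hd
    have he : ‖y - y'‖ ^ 2 = -‖x - R (x + z)‖ ^ 2 := by exact_mod_cast hd
    have hf : x - R (x + z) = 0 := by
      rw [← norm_eq_zero]
      nlinarith [sq_nonneg ‖y - y'‖, sq_nonneg ‖x - R (x + z)‖]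
    refine ⟨x + z, sub_eq_zero.mp hf, ?_⟩
    rw [← sub_eq_zero.mp hf]; abel
  · rintro ⟨w, rfl, rfl⟩
    exact hR w

/-- A self-adjoint operator has an absolute value. -/
theorem exists_isAbs {D : H →ₗ.[ℂ] H} (hD : IsSelfAdjoint D) : ∃ P, IsAbs D P := by
  obtain ⟨R, hR0, hR1, hR⟩ := exists_resolvent hD
  set B := CFC.sqrt R with hB
  set A := CFC.sqrt (1 - R) with hA
  have hB0 : 0 ≤ B := CFC.sqrt_nonneg _
  have hA0 : 0 ≤ A := CFC.sqrt_nonneg _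
  have hBB : B * B = R := CFC.sqrt_mul_sqrt_self R hR0
  have hAA : A * A = 1 - R := CFC.sqrt_mul_sqrt_self (1 - R) hR1
  have hcomm : Commute B A := by
    have h1 : Commute B (1 - R) :=
      (Commute.one_right B).sub_right ((Commute.refl R).cfcₙ_nnreal NNReal.sqrt)
    exact (h1.symm.cfcₙ_nnreal NNReal.sqrt).symm
  have hBsym : ∀ x y : H, inner ℂ (B x) y = inner ℂ x (B y) :=
    ((ContinuousLinearMap.nonneg_iff_isPositive B).mp hB0).1
  have hAsym : ∀ x y : H, inner ℂ (A x) y = inner ℂ x (A y) :=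
    ((ContinuousLinearMap.nonneg_iff_isPositive A).mp hA0).1
  have eBB : ∀ x, B (B x) = R x := fun x => DFunLike.congr_fun hBB x
  have eAA : ∀ x, A (A x) = x - R x := fun x => DFunLike.congr_fun hAA x
  have eBA : ∀ x, B (A x) = A (B x) := fun x => DFunLike.congr_fun hcomm.eq x
  have hinj : ∀ x, B x = 0 → x = 0 := by
    intro x hx
    have hRx : R x = 0 := by rw [← eBB, hx, map_zero]
    obtain ⟨y, h1, h2⟩ := (hR (R x) (x - R x)).mpr ⟨x, rfl, rfl⟩
    rw [hRx] at h1 h2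
    have hy : y = 0 := D.graph_fst_eq_zero_snd h1 rfl
    rw [hy, sub_zero] at h2
    exact D.graph_fst_eq_zero_snd h2 rfl
  let G : Submodule ℂ (H × H) := LinearMap.range (B.prod A).toLinearMap
  have memG : ∀ x y, (x, y) ∈ G ↔ ∃ w, x = B w ∧ y = A w := by
    intro x y
    constructor
    · rintro ⟨w, hw⟩
      exact ⟨w, (congrArg Prod.fst hw).symm, (congrArg Prod.snd hw).symm⟩
    · rintro ⟨w, rfl, rfl⟩
      exact ⟨w, rfl⟩
  have hG : ∀ x : H × H, x ∈ G → x.1 = 0 → x.2 = 0 := by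
    rintro ⟨x, y⟩ hx h0
    obtain ⟨w, rfl, rfl⟩ := (memG _ _).mp hx
    have : w = 0 := hinj w h0
    simp [this]
  have hgr : G.toLinearPMap.graph = G := G.toLinearPMap_graph_eq hG
  have hdense : Dense (G.toLinearPMap.domain : Set H) := by
    rw [Submodule.dense_iff_topologicalClosure_eq_top, Submodule.topologicalClosure_eq_top_iff,
      Submodule.eq_bot_iff]
    intro x hx
    apply hinj
    have h1 : B (B x) ∈ G.toLinearPMap.domain := by
      rw [Submodule.toLinearPMap_domain]
      exact ⟨(B (B x), A (B x)), (memG _ _).mpr ⟨_, rfl, rfl⟩, rfl⟩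
    have h2 := (Submodule.mem_orthogonal _ _).mp hx _ h1
    rw [hBsym] at h2
    exact inner_self_eq_zero.mp h2
  refine ⟨G.toLinearPMap, ?_, ?_, ?_⟩
  · rw [LinearPMap.isSelfAdjoint_def]
    apply LinearPMap.eq_of_eq_graph
    rw [LinearPMap.adjoint_graph_eq_graph_adjoint hdense, hgr]
    ext ⟨x, y⟩
    rw [Submodule.mem_adjoint_iff, memG]
    constructor
    · intro h
      have h1 : A x = B y := by
        refine ext_inner_left ℂ fun w => ?_
        rw [← hAsym, ← hBsym]
        exact sub_eq_zero.mp (h (B w) (A w) ((memG _ _).mpr ⟨w, rfl, rfl⟩))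
      refine ⟨B x + A y, ?_, ?_⟩
      · rw [map_add, eBB, eBA, ← h1, eAA]; abel
      · rw [map_add, ← eBA, h1, eAA, eBB]; abel
    · rintro ⟨w, rfl, rfl⟩ a b hab
      obtain ⟨v, rfl, rfl⟩ := (memG _ _).mp hab
      rw [hAsym, hBsym, eBA, sub_self]
  · intro x
    have hx : ((x : H), G.toLinearPMap x) ∈ G := by
      have h0 := G.toLinearPMap.mem_graph x
      rwa [hgr] at h0
    obtain ⟨w, h1, h2⟩ := (memG _ _).mp hx
    rw [h1, h2, ← hBsym, eBA, ← eBA]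
    have hpos : 0 ≤ B * A := Commute.mul_nonneg hB0 hA0 hcomm
    exact ((ContinuousLinearMap.nonneg_iff_isPositive _).mp hpos).re_inner_nonneg_left w
  · intro x z
    rw [hR, hgr]
    constructor
    · rintro ⟨y, h1, h2⟩
      obtain ⟨w, rfl, rfl⟩ := (memG _ _).mp h1
      obtain ⟨v, h3, rfl⟩ := (memG _ _).mp h2
      have hw : w = B (B w + A v) := by
        rw [map_add, eBB, eBA, ← h3, eAA]; abel
      have hv : v = A (B w + A v) := by
        rw [← sub_eq_zero]
        apply hinj
        rw [map_sub, ← h3, eBA, ← hw, sub_self]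
      refine ⟨B w + A v, ?_, ?_⟩
      · rw [← eBB, ← hw]
      · rw [← eAA, ← hv]
    · rintro ⟨w, rfl, rfl⟩
      refine ⟨A (B w), (memG _ _).mpr ⟨B w, (eBB w).symm, rfl⟩, (memG _ _).mpr ⟨A w, ?_, ?_⟩⟩
      · exact (eBA w).symm
      · exact (eAA w).symm

/-- The absolute value `|D|` of an unbounded self-adjoint operator `D`. -/
def absOp (D : H →ₗ.[ℂ] H) : H →ₗ.[ℂ] H := Classical.epsilon (IsAbs D)

theorem absOp_spec {D : H →ₗ.[ℂ] H} (hD : IsSelfAdjoint D) : IsAbs D (absOp D) :=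
  Classical.epsilon_spec (exists_isAbs hD)

/-! ### Commutators of bounded operators with an unbounded operator -/

/-- The bounded operator `T` preserves `Dom P` and `[P, T] = P T - T P`, defined on `Dom P`, is
the restriction of the bounded operator `S`; in terms of the graph of `P`, for all `ξ ∈ Dom P`
and `η = P ξ` one has `T ξ ∈ Dom P` and `P T ξ = T η + S ξ`. -/
def HasCommutator (P : H →ₗ.[ℂ] H) (T S : H →L[ℂ] H) : Prop :=
  ∀ ξ η : H, (ξ, η) ∈ P.graph → (T ξ, T η + S ξ) ∈ P.graph

open Classical in
/-- The bounded extension of `[P, T]` when `T` preserves `Dom P` and `[P, T]` is bounded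
(otherwise, the junk value `0`). -/
def comm (P : H →ₗ.[ℂ] H) (T : H →L[ℂ] H) : H →L[ℂ] H :=
  if h : ∃ S, HasCommutator P T S then h.choose else 0

/-- For densely defined `P`, the operator `comm P T` is the only bounded extension of `[P, T]`. -/
theorem HasCommutator.comm_eq {P : H →ₗ.[ℂ] H} (hP : Dense (P.domain : Set H))
    {T S : H →L[ℂ] H} (h : HasCommutator P T S) : comm P T = S := by
  have hex : ∃ S, HasCommutator P T S := ⟨S, h⟩
  have h1 : HasCommutator P T (comm P T) := by
    rw [comm, dif_pos hex]; exact hex.choose_spec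
  refine ContinuousLinearMap.coeFn_injective ?_
  refine Continuous.ext_on hP (comm P T).continuous S.continuous fun x hx => ?_
  have hx' := P.mem_graph ⟨x, hx⟩
  exact add_left_cancel (P.mem_graph_snd_inj (h1 _ _ hx') (h _ _ hx') rfl)

/-- `T` belongs to the domain of the `m`-th power of the derivation `δ = [P, ·]`, where the domain
of `δ` consists of the bounded operators preserving `Dom P` with bounded commutator with `P`. -/
def InDomDerivPow (P : H →ₗ.[ℂ] H) : ℕ → (H →L[ℂ] H) → Prop
  | 0, _ => True
  | m + 1, T => ∃ S, HasCommutator P T S ∧ InDomDerivPow P m S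

/-- The domain of the power `D ^ m`. -/
def powDomain (D : H →ₗ.[ℂ] H) : ℕ → Submodule ℂ H
  | 0 => ⊤
  | m + 1 => ((powDomain D m).comap D.toFun).map D.domain.subtype

/-- The smooth domain `H_∞`, the intersection of the domains of all powers `D ^ m`. -/
def smoothDomain (D : H →ₗ.[ℂ] H) : Submodule ℂ H := ⨅ m, powDomain D m

/-! ### Spectral triples -/

variable (H) in
/-- A spectral triple `(A, H, D)`: a unital involutive algebra `A` of bounded operators in `H` and
a self-adjoint operator `D` in `H` such that `[D, a]` is bounded for all `a ∈ A`. -/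
structure SpectralTriple where
  /-- the algebra -/
  A : StarSubalgebra ℂ (H →L[ℂ] H)
  /-- the operator -/
  D : H →ₗ.[ℂ] H
  selfAdjoint : IsSelfAdjoint D
  bounded_comm : ∀ a ∈ A, ∃ S, HasCommutator D a S

namespace SpectralTriple

variable (T : SpectralTriple H)

/-- The algebra is commutative. -/
def IsCommutative : Prop := ∀ a ∈ T.A, ∀ b ∈ T.A, a * b = b * a

/-- The bounded operator `[D, a]`. -/
def d (a : T.A) : H →L[ℂ] H := comm T.D (a : H →L[ℂ] H)

/-- Order one condition: `[[D, f], g] = 0` for all `f, g ∈ A`. -/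
def OrderOne : Prop := ∀ f g : T.A, T.d f * (g : H →L[ℂ] H) = (g : H →L[ℂ] H) * T.d f

/-- Regularity: for all `a ∈ A`, both `a` and `[D, a]` are in the domain of all powers of
`δ = [|D|, ·]`. -/
def IsRegular : Prop := ∀ (a : T.A) (m : ℕ),
  InDomDerivPow (absOp T.D) m (a : H →L[ℂ] H) ∧ InDomDerivPow (absOp T.D) m (T.d a)

/-- The spectrum of `A`: the space of (continuous) characters of `A`, with the weak-* topology.
Restriction identifies it with the Gelfand spectrum of the `C*`-algebra norm closure of `A`. -/
abbrev Spec : Type _ := WeakDual.characterSpace ℂ T.A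

/-- The support in `Spec A` of `b ∈ A`, seen as the continuous function `φ ↦ φ b`. -/
def supp (b : T.A) : Set T.Spec := tsupport fun φ : T.Spec => φ b

/-- A structure of Hermitian finite projective module on `H_∞`, absolutely continuous with respect
to a linear functional `lam` on `A`:
the `A`-module `H_∞` is identified, by `coord`, with `e Aⁿ` for a self-adjoint idempotent
`e ∈ Mₙ(A)`, and the `A`-valued inner product `(ξ|η) = ∑ ξᵢ* ηᵢ` satisfies
`⟨ξ, a η⟩ = lam (a (ξ|η))`. -/
structure HermitianFinite where
  smul_mem : ∀ (a : T.A) (ξ : smoothDomain T.D), (a : H →L[ℂ] H) (ξ : H) ∈ smoothDomain T.D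
  /-- the size of the idempotent -/
  n : ℕ
  /-- the idempotent -/
  e : Matrix (Fin n) (Fin n) T.A
  e_idem : e * e = e
  e_star : e.conjTranspose = e
  /-- the isomorphism of `H_∞` with `e Aⁿ` -/
  coord : smoothDomain T.D →ₗ[ℂ] (Fin n → T.A)
  coord_smul : ∀ (a : T.A) (ξ : smoothDomain T.D) (i : Fin n),
    coord ⟨(a : H →L[ℂ] H) (ξ : H), smul_mem a ξ⟩ i = a * coord ξ i
  coord_injective : Function.Injective coord
  range_coord : Set.range coord = {v | e.mulVec v = v}
  /-- the functional -/
  lam : T.A →ₗ[ℂ] ℂ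
  abs_cont : ∀ (a : T.A) (ξ η : smoothDomain T.D),
    inner ℂ (ξ : H) ((a : H →L[ℂ] H) (η : H)) =
      lam (a * ∑ i, star (coord ξ i) * coord η i)

/-- The `A`-valued inner product `(ξ|η) = ∑ ξᵢ* ηᵢ` on `H_∞`. -/
def HermitianFinite.herm {T : SpectralTriple H} (S : T.HermitianFinite)
    (ξ η : smoothDomain T.D) : T.A :=
  ∑ i, star (S.coord ξ i) * S.coord η i

end SpectralTriple

end ConnesSpectral

end

/-!
The proof rests on an operator inequality: for `k ∈ A` with `k ≥ 0` there is `M ≥ 0` such that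
`± i [D, k] ≤ M t + k / t` for all `t > 0`
(`ConnesSpectral.SpectralTriple.exists_commutator_bound`). Thus `[D, k]` is small where `k` is
small, and `k` will be `‖h‖ ∓ h`, which is small near a point where `|h|` is maximal.

*The inequality for `|D|`.* For bounded self-adjoint `Q` the function
`s ↦ ⟨x, e^{-isQ} k e^{isQ} x⟩` is nonnegative and its second derivative is bounded by the norm of
`[Q, [Q, k]]`; hence its derivative at `0` is controlled by its value. Applied to the
regularizations `|D| (1 + |D| / n)⁻¹`, whose iterated commutators with `k` are
bounded by those of `|D|`, this gives
`|⟨x, i [|D|, k] x⟩| ≤ ⟨x, k x⟩ / t + M t ‖x‖²` with `M = ‖[|D|, [|D|, k]]‖`.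

*From `|D|` to `D`.* The derivative in `τ` of `⟨e^{iτk} x, |D| e^{iτk} x⟩` is the expectation of
`i [|D|, k]` at `e^{iτk} x`, and the upper bound above is the same for all `τ` because `e^{iτk}`
commutes with `k`. By the order one condition
`⟨e^{iτk} x, D e^{iτk} x⟩ = ⟨x, D x⟩ + τ ⟨x, i [D, k] x⟩`. Since `-|D| ≤ D ≤ |D|`, letting `τ → ∞`
transfers the bound to `i [D, k]` (`ConnesSpectral.IsAbs.abs_inner_comm_le`). The domain questions
are settled by flowing inside the closed subspace of triples `(x, |D| x, D x)`.

*Consequences.* As `[D, k]` commutes with `k`, the inequality gives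
`‖[D, k] b‖ ≤ M t ‖b‖ + ‖k b‖ / t`, and the Gelfand transform shows that `‖k bₙ‖ → 0`. For smooth
`ξ`, absolute continuity and the density of `H_∞` show that `(ξ|B ξ) ≥ 0` whenever `B ≥ 0` commutes
with `A` (`ConnesSpectral.SpectralTriple.HermitianFinite.herm_nonneg`). Taking
`B = M t + k / t ± i [D, k]` shows that `χ (i (ξ|[D, k] ξ)) = 0` if `χ k = 0`.
Dissipativity follows by evaluating at a character `χ` where
`|χ x| = ‖x‖`, after multiplication of `x` by a phase.
-/

noncomputable section

namespace ConnesSpectral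

open Filter Topology Complex

variable {H : Type*} [NormedAddCommGroup H] [InnerProductSpace ℂ H]

/-! ### Graphs and powers of unbounded operators -/

theorem eq_of_mem_graph {D : H →ₗ.[ℂ] H} {a b c : H} (hb : (a, b) ∈ D.graph)
    (hc : (a, c) ∈ D.graph) : b = c := D.mem_graph_snd_inj hb hc rfl

theorem mem_powDomain_succ {D : H →ₗ.[ℂ] H} {m : ℕ} {x : H} :
    x ∈ powDomain D (m + 1) ↔ ∃ y, (x, y) ∈ D.graph ∧ y ∈ powDomain D m := by
  constructor
  · rintro ⟨z, hz, rfl⟩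
    exact ⟨D z, D.mem_graph z, hz⟩
  · rintro ⟨y, hxy, hy⟩
    obtain ⟨z, h1, h2⟩ := D.mem_graph_iff.mp hxy
    simp only at h1 h2
    refine ⟨z, ?_, h1⟩
    change D z ∈ powDomain D m
    rwa [h2]

theorem mem_smoothDomain_iff {D : H →ₗ.[ℂ] H} {x : H} :
    x ∈ smoothDomain D ↔ ∃ y, (x, y) ∈ D.graph ∧ y ∈ smoothDomain D := by
  simp only [smoothDomain, Submodule.mem_iInf]
  constructor
  · intro h
    obtain ⟨y, hxy, -⟩ := mem_powDomain_succ.mp (h 1)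
    refine ⟨y, hxy, fun m => ?_⟩
    obtain ⟨y', hxy', hy'⟩ := mem_powDomain_succ.mp (h (m + 1))
    rwa [eq_of_mem_graph hxy hxy']
  · rintro ⟨y, hxy, hy⟩ m
    cases m with
    | zero => trivial
    | succ m => exact mem_powDomain_succ.mpr ⟨y, hxy, hy m⟩

variable [CompleteSpace H]

/-! ### Self-adjoint unbounded operators and their resolvents -/

theorem inner_graph_comm {D : H →ₗ.[ℂ] H} (hD : IsSelfAdjoint D) {a b c d : H}
    (hab : (a, b) ∈ D.graph) (hcd : (c, d) ∈ D.graph) : inner ℂ b c = inner ℂ a d :=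
  (mem_graph_iff_of_selfAdjoint hD c d).mp hcd a b hab

theorem isClosed_graph {D : H →ₗ.[ℂ] H} (hD : IsSelfAdjoint D) :
    IsClosed (D.graph : Set (H × H)) := hD.isClosed

theorem IsAbs.inner_graph_nonneg {D P : H →ₗ.[ℂ] H} (h : IsAbs D P) {x y : H}
    (hxy : (x, y) ∈ P.graph) : 0 ≤ (inner ℂ x y).re := by
  obtain ⟨z, h1, h2⟩ := P.mem_graph_iff.mp hxy
  have h3 := h.2.1 z
  simp only at h1 h2
  rw [h1, h2, ← inner_conj_symm, conj_re] at h3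
  exact h3

/-- The resolvent `(1 + s P)⁻¹` of a positive self-adjoint operator `P`, for `s > 0`. -/
theorem exists_resolvent_of_nonneg {P : H →ₗ.[ℂ] H} (hP : IsSelfAdjoint P)
    (hP0 : ∀ x y, (x, y) ∈ P.graph → 0 ≤ (inner ℂ x y).re) {s : ℝ} (hs : 0 < s) :
    ∃ r : H →L[ℂ] H, (∀ w, ‖r w‖ ≤ ‖w‖) ∧ (∀ w, ∃ v, (r w, v) ∈ P.graph ∧ w = r w + (s : ℂ) • v) ∧
      ∀ x y, (x, y) ∈ P.graph → r (x + (s : ℂ) • y) = x := by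
  let f : P.graph →L[ℂ] H := (ContinuousLinearMap.fst ℂ H H + (s : ℂ) •
    ContinuousLinearMap.snd ℂ H H).comp P.graph.subtypeL
  have hf : ∀ z : P.graph, f z = z.1.1 + (s : ℂ) • z.1.2 := fun z => rfl
  have hn : ∀ z : P.graph, ‖z.1.1‖ ^ 2 + s ^ 2 * ‖z.1.2‖ ^ 2 ≤ ‖f z‖ ^ 2 := by
    intro z
    have h0 := hP0 z.1.1 z.1.2 z.2
    rw [hf, @norm_add_sq ℂ, inner_smul_right, norm_smul, mul_pow]
    simp only [RCLike.re_to_complex, re_ofReal_mul, norm_real, Real.norm_eq_abs, sq_abs]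
    nlinarith [mul_nonneg hs.le h0]
  have hn1 : ∀ z : P.graph, ‖z.1.1‖ ≤ ‖f z‖ := fun z =>
    le_of_sq_le_sq (le_trans (by nlinarith [sq_nonneg (s * ‖z.1.2‖)]) (hn z)) (norm_nonneg _)
  have hn2 : ∀ z : P.graph, ‖z.1.2‖ ≤ s⁻¹ * ‖f z‖ := fun z => by
    rw [inv_mul_eq_div, le_div_iff₀ hs]
    exact le_of_sq_le_sq (le_trans (by nlinarith [sq_nonneg (‖z.1.1‖)]) (hn z)) (norm_nonneg _)
  have : CompleteSpace P.graph := (isClosed_graph hP).completeSpace_coe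
  -- `1 + s P` is bounded below on the graph of `P`, so its range is closed.
  have hanti : AntilipschitzWith (Real.toNNReal (1 + s⁻¹)) f := by
    refine ContinuousLinearMap.antilipschitz_of_bound f fun z => ?_
    have hs' : 0 < s⁻¹ := inv_pos.mpr hs
    rw [Real.coe_toNNReal _ (by positivity)]
    have h1 := hn1 z
    have h2 := hn2 z
    have h3 := norm_nonneg (f z)
    refine max_le ?_ ?_
    · change ‖z.1.1‖ ≤ _
      nlinarith [mul_nonneg hs'.le h3]
    · change ‖z.1.2‖ ≤ _
      nlinarith
  have hcl : IsClosed (LinearMap.range f.toLinearMap : Set H) :=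
    hanti.isClosed_range f.uniformContinuous
  have hsurj : LinearMap.range f.toLinearMap = ⊤ := by
    have : (LinearMap.range f.toLinearMap).topologicalClosure = ⊤ := by
      rw [Submodule.topologicalClosure_eq_top_iff, Submodule.eq_bot_iff]
      intro z hz
      rw [Submodule.mem_orthogonal] at hz
      -- A vector orthogonal to the range is an eigenvector of `P` for the eigenvalue `-1/s < 0`.
      have h1 : (z, -((s : ℂ)⁻¹ • z)) ∈ P.graph := by
        rw [mem_graph_iff_of_selfAdjoint hP]
        intro u v huv
        have h2 := hz _ ⟨⟨(u, v), huv⟩, rfl⟩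
        have h3 : inner ℂ (u + (s : ℂ) • v) z = 0 := h2
        rw [inner_add_left, inner_smul_left, conj_ofReal] at h3
        rw [inner_neg_right, inner_smul_right]
        have hs' : (s : ℂ) ≠ 0 := by exact_mod_cast hs.ne'
        field_simp
        linear_combination h3
      have h2 := hP0 _ _ h1
      rw [inner_neg_right, inner_smul_right, inner_self_eq_norm_sq_to_K] at h2
      have h3 : 0 ≤ -(s⁻¹ * ‖z‖ ^ 2) := by
        have : (-((s : ℂ)⁻¹ * ((‖z‖ : ℂ)) ^ 2)).re = -(s⁻¹ * ‖z‖ ^ 2) := by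
          norm_cast
        rw [← this]; exact h2
      have h4 : 0 < s⁻¹ := inv_pos.mpr hs
      by_contra hz0
      have : 0 < ‖z‖ := norm_pos_iff.mpr hz0
      have : 0 < s⁻¹ * ‖z‖ ^ 2 := by positivity
      linarith
    rwa [hcl.submodule_topologicalClosure_eq] at this
  let e : P.graph ≃ₗ[ℂ] H := LinearEquiv.ofBijective f.toLinearMap
    ⟨hanti.injective, LinearMap.range_eq_top.mp hsurj⟩
  have he : ∀ w, f (e.symm w) = w := fun w => e.apply_symm_apply w
  let r : H →L[ℂ] H := LinearMap.mkContinuous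
    ((LinearMap.fst ℂ H H).comp (P.graph.subtype.comp e.symm.toLinearMap)) 1 (by
      intro w
      rw [one_mul]
      have := hn1 (e.symm w)
      rwa [he] at this)
  have hr : ∀ w, r w = (e.symm w).1.1 := fun w => rfl
  refine ⟨r, ?_, ?_, ?_⟩
  · intro w
    have := hn1 (e.symm w)
    rwa [he] at this
  · intro w
    refine ⟨(e.symm w).1.2, ?_, ?_⟩
    · rw [hr]; exact (e.symm w).2
    · rw [hr, ← hf, he]
  · intro x y hxy
    have : x + (s : ℂ) • y = e ⟨(x, y), hxy⟩ := rfl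
    rw [hr, this, e.symm_apply_apply]

/-- Regularization of a positive self-adjoint operator `P`: with `r n = (1 + P / (n + 1))⁻¹`, the
bounded self-adjoint operators `Q n = P (1 + P / (n + 1))⁻¹` satisfy `[Q n, T] = r n [P, T] r n`,
and `r n` tends strongly to the identity. -/
theorem exists_yosida {P : H →ₗ.[ℂ] H} (hP : IsSelfAdjoint P)
    (hP0 : ∀ x y, (x, y) ∈ P.graph → 0 ≤ (inner ℂ x y).re) :
    ∃ r Q : ℕ → H →L[ℂ] H, (∀ n, ‖r n‖ ≤ 1) ∧ (∀ n, IsSelfAdjoint (r n)) ∧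
      (∀ n, IsSelfAdjoint (Q n)) ∧ (∀ n, Commute (r n) (Q n)) ∧
      (∀ n w, (r n w, Q n w) ∈ P.graph) ∧
      (∀ n x y, (x, y) ∈ P.graph → Q n x = r n y) ∧
      (∀ n T S, HasCommutator P T S → Q n * T - T * Q n = r n * S * r n) ∧
      ∀ x, Tendsto (fun n => r n x) atTop (𝓝 x) := by
  have hs : ∀ n : ℕ, (0 : ℝ) < 1 / ((n : ℝ) + 1) := fun n => by positivity
  choose r hr1 hr2 hr3 using fun n : ℕ => exists_resolvent_of_nonneg hP hP0 (hs n)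
  set s : ℕ → ℂ := fun n => ((1 / ((n : ℝ) + 1) : ℝ) : ℂ) with hsdef
  have hs0 : ∀ n, s n ≠ 0 := fun n => by
    simp only [hsdef]; exact_mod_cast (hs n).ne'
  let Q : ℕ → H →L[ℂ] H := fun n => (s n)⁻¹ • (1 - r n)
  have hQ : ∀ n w, w = r n w + s n • Q n w := by
    intro n w
    have : Q n w = (s n)⁻¹ • (w - r n w) := rfl
    rw [this, smul_inv_smul₀ (hs0 n)]; abel
  have hgr : ∀ n w, (r n w, Q n w) ∈ P.graph := by
    intro n w
    obtain ⟨v, h1, h2⟩ := hr2 n w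
    have h3 : s n • Q n w = s n • v := add_left_cancel ((hQ n w).symm.trans h2)
    rw [smul_right_injective H (hs0 n) h3]
    exact h1
  have hQr : ∀ n x y, (x, y) ∈ P.graph → Q n x = r n y := by
    intro n x y hxy
    have h1 := hr3 n x y hxy
    rw [map_add, map_smul] at h1
    have h2 := hQ n x
    have h3 : s n • Q n x = s n • r n y := add_left_cancel (h2.symm.trans h1.symm)
    exact smul_right_injective H (hs0 n) h3
  have hrsa : ∀ n, IsSelfAdjoint (r n) := by
    intro n
    rw [ContinuousLinearMap.isSelfAdjoint_iff_isSymmetric]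
    intro x y
    change inner ℂ (r n x) y = inner ℂ x (r n y)
    conv_lhs => rw [hQ n y]
    conv_rhs => rw [hQ n x]
    rw [inner_add_left, inner_add_right, inner_smul_left, inner_smul_right,
      inner_graph_comm hP (hgr n x) (hgr n y), conj_ofReal]
  have hrn : ∀ n, ‖r n‖ ≤ 1 := fun n =>
    (r n).opNorm_le_bound zero_le_one fun w => by rw [one_mul]; exact hr1 n w
  refine ⟨r, Q, hrn, hrsa, ?_, ?_, hgr, hQr, ?_, ?_⟩
  · intro n
    have h1 : IsSelfAdjoint (s n)⁻¹ := by
      rw [isSelfAdjoint_iff, RCLike.star_def, map_inv₀, conj_ofReal]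
    exact h1.smul ((IsSelfAdjoint.one _).sub (hrsa n))
  · intro n
    exact ((Commute.one_right _).sub_right (Commute.refl _)).smul_right _
  · intro n T S hTS
    ext w
    have h1 := hr3 n _ _ (hTS _ _ (hgr n w))
    have h2 : T (r n w) + s n • (T (Q n w) + S (r n w)) = T w + s n • S (r n w) := by
      rw [smul_add, ← add_assoc]
      congr 1
      conv_rhs => rw [hQ n w, map_add, map_smul]
    rw [h2, map_add, map_smul] at h1
    have h3 := hQ n (T w)
    have h4 : T w = T (r n w) + s n • T (Q n w) := by
      conv_lhs => rw [hQ n w]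
      rw [map_add, map_smul]
    refine smul_right_injective H (hs0 n) ?_
    change s n • (Q n (T w) - T (Q n w)) = s n • r n (S (r n w))
    rw [smul_sub]
    have e1 : s n • Q n (T w) = T w - r n (T w) := by
      rw [eq_sub_iff_add_eq, add_comm]; exact h3.symm
    have e2 : s n • T (Q n w) = T w - T (r n w) := by
      rw [eq_sub_iff_add_eq, add_comm]; exact h4.symm
    rw [e1, e2, ← h1]; abel
  · have hdom : ∀ x y, (x, y) ∈ P.graph → Tendsto (fun n => r n x) atTop (𝓝 x) := by
      intro x y hxy
      rw [tendsto_iff_norm_sub_tendsto_zero]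
      have hlim : Tendsto (fun n : ℕ => 1 / ((n : ℝ) + 1) * ‖y‖) atTop (𝓝 0) := by
        simpa using tendsto_one_div_add_atTop_nhds_zero_nat.mul_const ‖y‖
      refine squeeze_zero (fun _ => norm_nonneg _) (fun n => ?_) hlim
      have h1 : r n x - x = -(s n • r n y) := by
        rw [← hQr n x y hxy]
        nth_rewrite 2 [hQ n x]
        abel
      rw [h1, norm_neg, norm_smul]
      refine mul_le_mul ?_ (hr1 n y) (norm_nonneg _) (hs n).le
      simp only [hsdef, norm_real, Real.norm_eq_abs, abs_of_pos (hs n), le_refl]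
    intro x
    rw [Metric.tendsto_atTop]
    intro ε hε
    obtain ⟨x', hx', hd⟩ := Metric.mem_closure_iff.mp (hP.dense_domain x) (ε / 3) (by positivity)
    obtain ⟨N, hN⟩ := (Metric.tendsto_atTop.mp
      (hdom x' _ (P.mem_graph ⟨x', hx'⟩))) (ε / 3) (by positivity)
    refine ⟨N, fun n hn => ?_⟩
    have h1 : dist (r n x) (r n x') ≤ dist x x' := by
      rw [dist_eq_norm, dist_eq_norm, ← map_sub]
      exact hr1 n _
    have h2 := hN n hn
    have h3 := dist_triangle4 (r n x) (r n x') x' x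
    rw [dist_comm x' x] at h3
    linarith

/-! ### Comparison of a self-adjoint operator with its absolute value -/

/-- If `R = (1 + D²)⁻¹`, then `D R` is a bounded self-adjoint operator which commutes with `R`
and has square `R (1 - R)`. -/
theorem exists_mul_resolvent {D : H →ₗ.[ℂ] H} (hD : IsSelfAdjoint D) {R : H →L[ℂ] H}
    (hR0 : 0 ≤ R) (hR : ∀ w, ∃ y, (R w, y) ∈ D.graph ∧ (y, w - R w) ∈ D.graph) :
    ∃ Y : H →L[ℂ] H, IsSelfAdjoint Y ∧ Commute Y R ∧ Y * Y = R * (1 - R) ∧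
      ∀ w, (R w, Y w) ∈ D.graph ∧ (Y w, w - R w) ∈ D.graph := by
  choose y hy1 hy2 using hR
  let Y₀ : H →ₗ[ℂ] H :=
    { toFun := y
      map_add' := fun a b => eq_of_mem_graph (hy1 (a + b)) (by
        rw [map_add]; exact D.graph.add_mem (hy1 a) (hy1 b))
      map_smul' := fun c a => eq_of_mem_graph (hy1 (c • a)) (by
        rw [map_smul]; exact D.graph.smul_mem c (hy1 a)) }
  have hRsym : ∀ x z : H, inner ℂ (R x) z = inner ℂ x (R z) :=
    ((ContinuousLinearMap.nonneg_iff_isPositive R).mp hR0).1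
  let Y : H →L[ℂ] H := Y₀.mkContinuous (1 + ‖R‖) (by
    intro w
    change ‖y w‖ ≤ _
    have h1 : inner ℂ (y w) (y w) = inner ℂ (R w) (w - R w) :=
      inner_graph_comm hD (hy1 w) (hy2 w)
    have h2 : ‖y w‖ ^ 2 ≤ ‖R w‖ * ‖w - R w‖ := by
      rw [← @inner_self_eq_norm_sq ℂ, h1]
      exact (re_le_norm _).trans (norm_inner_le_norm _ _)
    have h3 := R.le_opNorm w
    have h4 : ‖w - R w‖ ≤ ‖w‖ + ‖R‖ * ‖w‖ := (norm_sub_le _ _).trans (by gcongr)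
    refine le_of_sq_le_sq (h2.trans ?_) (by positivity)
    calc ‖R w‖ * ‖w - R w‖ ≤ (‖R‖ * ‖w‖) * (‖w‖ + ‖R‖ * ‖w‖) := by gcongr
      _ ≤ ((1 + ‖R‖) * ‖w‖) ^ 2 := by
        nlinarith [norm_nonneg R, norm_nonneg w, mul_nonneg (norm_nonneg R) (sq_nonneg ‖w‖),
          sq_nonneg ‖w‖])
  have hY1 : ∀ w, (R w, Y w) ∈ D.graph := hy1
  have hY2 : ∀ w, (Y w, w - R w) ∈ D.graph := hy2
  have hsym : ∀ v w, inner ℂ (Y v) w = inner ℂ v (Y w) := by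
    intro v w
    have h1 := inner_graph_comm hD (hY1 v) (hY1 w)
    have h2 := inner_graph_comm hD (hY2 v) (hY2 w)
    rw [inner_sub_left, inner_sub_right] at h2
    linear_combination h1 - h2
  refine ⟨Y, ?_, ?_, ?_, fun w => ⟨hY1 w, hY2 w⟩⟩
  · rw [ContinuousLinearMap.isSelfAdjoint_iff_isSymmetric]
    exact hsym
  · ext w
    refine ext_inner_right ℂ fun v => ?_
    change inner ℂ (Y (R w)) v = inner ℂ (R (Y w)) v
    rw [hsym, hRsym (Y w) v]
    exact (inner_graph_comm hD (hY1 w) (hY1 v)).symm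
  · ext w
    refine ext_inner_right ℂ fun v => ?_
    change inner ℂ (Y (Y w)) v = inner ℂ (R (w - R w)) v
    rw [hsym, inner_graph_comm hD (hY1 w) (hY2 v), inner_sub_right, hRsym, map_sub,
      inner_sub_left, hRsym w v, hRsym (R w) v]

/-- With `R = (1 + D²)⁻¹`, the operator `|D| R` is the absolute value of the bounded operator `D R`,
and both commute with `R`; hence `-|D| ≤ D ≤ |D|` on the range of `R`, the domain of `D²`. -/
theorem IsAbs.abs_inner_le_of_sq {D P : H →ₗ.[ℂ] H} (hD : IsSelfAdjoint D) (h : IsAbs D P)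
    {a b c b' : H} (hab : (a, b) ∈ P.graph)
    (hab' : (a, b') ∈ D.graph) (hbc' : (b', c) ∈ D.graph) :
    |(inner ℂ a b').re| ≤ (inner ℂ a b).re := by
  obtain ⟨R, hR0, -, hR⟩ := exists_resolvent hD
  obtain ⟨Y, hYsa, hYR, hYY, hY⟩ := exists_mul_resolvent hD hR0
    fun w => (hR (R w) (w - R w)).mpr ⟨w, rfl, rfl⟩
  obtain ⟨Z, hZsa, hZR, hZZ, hZ⟩ := exists_mul_resolvent h.1 hR0
    fun w => (h.2.2 _ _).mpr ((hR (R w) (w - R w)).mpr ⟨w, rfl, rfl⟩)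
  have hZ0 : 0 ≤ Z := by
    rw [ContinuousLinearMap.nonneg_iff_isPositive, ContinuousLinearMap.isPositive_def]
    refine ⟨ContinuousLinearMap.isSelfAdjoint_iff_isSymmetric.mp hZsa, fun w => ?_⟩
    have h1 := h.inner_graph_nonneg (hZ w).1
    have h2 := h.inner_graph_nonneg (hZ w).2
    have h3 : inner ℂ w (Z w) = inner ℂ (R w) (Z w) + inner ℂ (w - R w) (Z w) := by
      rw [← inner_add_left, add_sub_cancel]
    rw [ContinuousLinearMap.reApplyInnerSelf_apply, ← inner_conj_symm, RCLike.conj_re, h3]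
    have h4 : (inner ℂ (w - R w) (Z w)).re = (inner ℂ (Z w) (w - R w)).re := by
      rw [← inner_conj_symm, conj_re]
    simp only [RCLike.re_to_complex, add_re, h4]
    exact add_nonneg h1 h2
  have hZabs : CFC.abs Y = Z :=
    CFC.sqrt_unique (by rw [hYsa.star_eq, hYY, hZZ]) hZ0
  have key : ∀ B : H →L[ℂ] H, 0 ≤ B → Commute R B → ∀ w, 0 ≤ (inner ℂ (R w) (B w)).re := by
    intro B hB hc w
    have h1 := (ContinuousLinearMap.nonneg_iff_isPositive _).mp (Commute.mul_nonneg hR0 hB hc)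
    have h2 := h1.re_inner_nonneg_right w
    have h3 : inner ℂ w ((R * B) w) = inner ℂ (R w) (B w) :=
      (((ContinuousLinearMap.nonneg_iff_isPositive R).mp hR0).1 w (B w)).symm
    rwa [h3] at h2
  obtain ⟨w, ha, -⟩ := (hR a c).mp ⟨b', hab', hbc'⟩
  subst ha
  rw [eq_of_mem_graph hab (hZ w).1, eq_of_mem_graph hab' (hY w).1]
  have h1 : 0 ≤ Z - Y := by
    rw [← hZabs, CFC.abs_sub_self Y hYsa]
    exact nsmul_nonneg (CFC.negPart_nonneg Y) 2
  have h2 : 0 ≤ Z + Y := by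
    rw [← hZabs, CFC.abs_add_self Y hYsa]
    exact nsmul_nonneg (CFC.posPart_nonneg Y) 2
  have h3 := key _ h1 (hZR.symm.sub_right hYR.symm) w
  have h4 := key _ h2 (hZR.symm.add_right hYR.symm) w
  rw [sub_apply, inner_sub_right, sub_re] at h3
  rw [add_apply, inner_add_right, add_re] at h4
  rw [abs_le]
  constructor <;> linarith

/-- The domain of `|D|` is contained in that of `D`, and `-|D| ≤ D ≤ |D|` there. -/
theorem IsAbs.exists_mem_graph {D P : H →ₗ.[ℂ] H} (hD : IsSelfAdjoint D) (h : IsAbs D P)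
    {x p : H} (hxp : (x, p) ∈ P.graph) :
    ∃ q, (x, q) ∈ D.graph ∧ |(inner ℂ x q).re| ≤ (inner ℂ x p).re := by
  obtain ⟨r, Q, -, -, -, -, hgr, hQr, -, hlim⟩ :=
    exists_yosida h.1 fun _ _ => h.inner_graph_nonneg
  -- `r n x` lies in the common domain of `P² = D²` and approximates `x` for the graph norm of `P`.
  have h1 : ∀ n, (r n x, r n p) ∈ P.graph := fun n => by
    rw [← hQr n x p hxp]; exact hgr n x
  have h2 : ∀ n, (r n p, Q n p) ∈ P.graph := fun n => hgr n p
  choose q hq1 hq2 using fun n => (h.2.2 (r n x) (Q n p)).mp ⟨_, h1 n, h2 n⟩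
  have hdist : ∀ m n, dist (q m) (q n) = dist (r m p) (r n p) := by
    intro m n
    have e1 := inner_graph_comm hD (D.graph.sub_mem (hq1 m) (hq1 n))
      (D.graph.sub_mem (hq2 m) (hq2 n))
    have e2 := inner_graph_comm h.1 (P.graph.sub_mem (h1 m) (h1 n))
      (P.graph.sub_mem (h2 m) (h2 n))
    have e3 := congrArg RCLike.re (e1.trans e2.symm)
    rw [inner_self_eq_norm_sq, inner_self_eq_norm_sq] at e3
    rw [dist_eq_norm, dist_eq_norm]
    exact (sq_eq_sq₀ (norm_nonneg _) (norm_nonneg _)).mp e3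
  have hc : CauchySeq q := by
    have := (hlim p).cauchySeq
    rw [Metric.cauchySeq_iff] at this ⊢
    simpa only [hdist] using this
  obtain ⟨q', hq'⟩ := cauchySeq_tendsto_of_complete hc
  refine ⟨q', (isClosed_graph hD).mem_of_tendsto ((hlim x).prodMk_nhds hq')
    (Eventually.of_forall hq1), ?_⟩
  have l1 : Tendsto (fun n => |(inner ℂ (r n x) (q n)).re|) atTop (𝓝 |(inner ℂ x q').re|) :=
    ((continuous_re.tendsto _).comp ((hlim x).inner hq')).abs
  have l2 : Tendsto (fun n => (inner ℂ (r n x) (r n p)).re) atTop (𝓝 (inner ℂ x p).re) :=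
    (continuous_re.tendsto _).comp ((hlim x).inner (hlim p))
  exact le_of_tendsto_of_tendsto' l1 l2 fun n =>
    h.abs_inner_le_of_sq hD (h1 n) (hq1 n) (hq2 n)

/-! ### The flow of a bounded operator -/

/-- A closed subspace invariant under `K` contains the orbits `τ ↦ exp (i τ K) z` of its points. -/
theorem exists_flow {E : Type*} [NormedAddCommGroup E] [NormedSpace ℂ E] [CompleteSpace E]
    (K : E →L[ℂ] E) (G : Submodule ℂ E) (hG : IsClosed (G : Set E)) (hK : ∀ z ∈ G, K z ∈ G)
    {z : E} (hz : z ∈ G) :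
    ∃ γ : ℝ → E, γ 0 = z ∧ (∀ τ, γ τ ∈ G) ∧ ∀ τ, HasDerivAt γ (I • K (γ τ)) τ := by
  refine ⟨fun τ => NormedSpace.exp (τ • (I • K)) z, ?_, fun τ => ?_, fun τ => ?_⟩
  · simp
  · set X : E →L[ℂ] E := τ • (I • K) with hX
    have hXG : ∀ z ∈ G, X z ∈ G := fun z hz => by
      have : X z = (τ : ℂ) • (I • K z) := by simp [hX]
      rw [this]
      exact G.smul_mem _ (G.smul_mem _ (hK z hz))
    have hpow : ∀ n : ℕ, (X ^ n) z ∈ G := fun n => by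
      induction n with
      | zero => simpa using hz
      | succ n ih => rw [pow_succ']; exact hXG _ ih
    have hs := (NormedSpace.exp_series_hasSum_exp' (𝕂 := ℂ) X).mapL
      (ContinuousLinearMap.apply ℂ E z)
    exact hG.mem_of_tendsto hs (Eventually.of_forall fun s => G.sum_mem fun n _ =>
      G.smul_mem _ (hpow n))
  · have h1 := hasDerivAt_exp_smul_const' (𝕂 := ℝ) (I • K) τ
    exact ((ContinuousLinearMap.apply ℂ E z).restrictScalars ℝ).hasFDerivAt.comp_hasDerivAt τ h1

theorem hasDerivAt_inner_flow {k : H →L[ℂ] H} (hk : IsSelfAdjoint k) (B : H →L[ℂ] H)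
    {η : ℝ → H} (hη : ∀ τ, HasDerivAt η (I • k (η τ)) τ) (τ : ℝ) :
    HasDerivAt (fun τ => inner ℂ (η τ) (B (η τ)))
      (inner ℂ (η τ) ((I • (B * k - k * B)) (η τ))) τ := by
  have h1 : HasDerivAt (fun τ => B (η τ)) (B (I • k (η τ))) τ :=
    (B.restrictScalars ℝ).hasFDerivAt.comp_hasDerivAt τ (hη τ)
  refine ((hη τ).inner ℂ h1).congr_deriv ?_
  have h2 : inner ℂ (k (η τ)) (B (η τ)) = inner ℂ (η τ) (k (B (η τ))) :=
    (ContinuousLinearMap.isSelfAdjoint_iff_isSymmetric.mp hk) _ _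
  simp only [smul_apply, sub_apply, mul_apply_eq_comp, map_smul, inner_smul_left,
    inner_smul_right, inner_sub_right, conj_I, h2]
  ring

theorem inner_flow_eq {k : H →L[ℂ] H} (hk : IsSelfAdjoint k) {B : H →L[ℂ] H} (hB : Commute B k)
    {η : ℝ → H} (hη : ∀ τ, HasDerivAt η (I • k (η τ)) τ) (τ : ℝ) :
    inner ℂ (η τ) (B (η τ)) = inner ℂ (η 0) (B (η 0)) := by
  have h1 : ∀ τ, HasDerivAt (fun τ => inner ℂ (η τ) (B (η τ))) 0 τ := fun τ => by
    have := hasDerivAt_inner_flow hk B hη τ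
    rwa [hB.eq, sub_self, smul_zero, zero_apply, inner_zero_right] at this
  exact is_const_of_deriv_eq_zero (fun τ => (h1 τ).differentiableAt) (fun τ => (h1 τ).deriv) τ 0

theorem norm_flow_eq {k : H →L[ℂ] H} (hk : IsSelfAdjoint k)
    {η : ℝ → H} (hη : ∀ τ, HasDerivAt η (I • k (η τ)) τ) (τ : ℝ) : ‖η τ‖ = ‖η 0‖ := by
  have h1 := congrArg RCLike.re (inner_flow_eq hk (Commute.one_left k) hη τ)
  simp only [one_apply_eq_self, inner_self_eq_norm_sq] at h1
  exact (sq_eq_sq₀ (norm_nonneg _) (norm_nonneg _)).mp h1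

/-! ### Commutators with a positive element, at the first order -/

/-- A nonnegative function with bounded second derivative has a small derivative where it is
small. -/
theorem abs_deriv_le_of_nonneg {f f' f'' : ℝ → ℝ} {M : ℝ} (hf0 : ∀ τ, 0 ≤ f τ)
    (hf : ∀ τ, HasDerivAt f (f' τ) τ) (hf' : ∀ τ, HasDerivAt f' (f'' τ) τ)
    (hM : ∀ τ, |f'' τ| ≤ M) {t : ℝ} (ht : 0 < t) : |f' 0| ≤ f 0 / t + M * t := by
  have h1 : ∀ τ, |f' τ - f' 0| ≤ M * |τ| := fun τ => by
    have := Convex.norm_image_sub_le_of_norm_hasDerivWithin_le (s := Set.univ) (x := 0) (y := τ)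
      (fun x _ => (hf' x).hasDerivWithinAt) (fun x _ => hM x) convex_univ trivial trivial
    simpa using this
  have h2 : ∀ τ, f τ - f 0 - τ * f' 0 ≤ M * τ ^ 2 := fun τ => by
    have hg : ∀ x, HasDerivAt (fun x => f x - x * f' 0) (f' x - f' 0) x := fun x => by
      simpa using (hf x).fun_sub ((hasDerivAt_id x).mul_const (f' 0))
    have := Convex.norm_image_sub_le_of_norm_hasDerivWithin_le (s := Set.uIcc 0 τ) (x := 0) (y := τ)
      (C := M * |τ|) (fun x _ => (hg x).hasDerivWithinAt) (fun x hx => (h1 x).trans ?_)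
      (convex_uIcc 0 τ) Set.left_mem_uIcc Set.right_mem_uIcc
    · have h3 := (le_abs_self _).trans this
      rw [sub_zero, Real.norm_eq_abs, mul_assoc, abs_mul_abs_self] at h3
      nlinarith
    · have hM0 : 0 ≤ M := (abs_nonneg _).trans (hM 0)
      refine mul_le_mul_of_nonneg_left ?_ hM0
      simpa using Set.abs_sub_left_of_mem_uIcc hx
  have h3 := h2 t
  have h4 := h2 (-t)
  have h5 := hf0 t
  have h6 := hf0 (-t)
  have h7 : t * |f' 0| ≤ f 0 + M * t ^ 2 := by
    rcases abs_cases (f' 0) with ⟨h, -⟩ | ⟨h, -⟩ <;> rw [h] <;> nlinarith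
  have h8 : f 0 / t + M * t = (f 0 + M * t ^ 2) / t := by field_simp
  rw [h8, le_div_iff₀ ht]
  linarith

/-- For `k ≥ 0` the function `τ ↦ ⟨x, e^{-iτQ} k e^{iτQ} x⟩` is nonnegative, so its derivative at
`0` is controlled by its value and by the double commutator `[Q, [Q, k]]`. -/
theorem abs_inner_commutator_le {Q k : H →L[ℂ] H} (hQ : IsSelfAdjoint Q) (hk : 0 ≤ k) {M : ℝ}
    (hM : ‖Q * (Q * k - k * Q) - (Q * k - k * Q) * Q‖ ≤ M) (x : H) {t : ℝ} (ht : 0 < t) :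
    |(inner ℂ x ((I • (Q * k - k * Q)) x)).re| ≤
      (inner ℂ x (k x)).re / t + M * ‖x‖ ^ 2 * t := by
  obtain ⟨η, h0, -, hη⟩ := exists_flow Q ⊤ isClosed_univ (fun _ _ => trivial)
    (z := x) trivial
  set B : H →L[ℂ] H := I • (k * Q - Q * k) with hB
  have hre : ∀ {g : ℝ → ℂ} {g' : ℂ} {τ : ℝ}, HasDerivAt g g' τ →
      HasDerivAt (fun τ => (g τ).re) g'.re τ := fun h =>
    reCLM.hasFDerivAt.comp_hasDerivAt _ h
  have key := abs_deriv_le_of_nonneg (f := fun τ => (inner ℂ (η τ) (k (η τ))).re)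
    (f' := fun τ => (inner ℂ (η τ) (B (η τ))).re)
    (f'' := fun τ => (inner ℂ (η τ) ((I • (B * Q - Q * B)) (η τ))).re) (M := M * ‖x‖ ^ 2)
    (fun τ => ((ContinuousLinearMap.nonneg_iff_isPositive k).mp hk).re_inner_nonneg_right (η τ))
    (fun τ => hre (hasDerivAt_inner_flow hQ k hη τ))
    (fun τ => hre (hasDerivAt_inner_flow hQ B hη τ)) (fun τ => ?_) ht
  · have hneg : I • (Q * k - k * Q) = -B := by rw [hB, ← smul_neg, neg_sub]
    rw [hneg, neg_apply, inner_neg_right, neg_re, abs_neg]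
    simpa only [h0] using key
  · have h1 : I • (B * Q - Q * B) = -(Q * (Q * k - k * Q) - (Q * k - k * Q) * Q) := by
      simp only [hB, smul_mul_assoc, mul_smul_comm, ← smul_sub, smul_smul, I_mul_I, neg_smul,
        one_smul]
      noncomm_ring
    have h2 : ‖I • (B * Q - Q * B)‖ ≤ M := by rwa [h1, norm_neg]
    calc |(inner ℂ (η τ) ((I • (B * Q - Q * B)) (η τ))).re|
        ≤ ‖η τ‖ * ‖(I • (B * Q - Q * B)) (η τ)‖ :=
          (abs_re_le_norm _).trans (norm_inner_le_norm _ _)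
      _ ≤ ‖η τ‖ * (M * ‖η τ‖) := by
          gcongr
          exact ContinuousLinearMap.le_of_opNorm_le _ h2 _
      _ = M * ‖x‖ ^ 2 := by rw [norm_flow_eq hQ hη, h0]; ring

/-- The estimate of `abs_inner_commutator_le` for an unbounded `P ≥ 0`, with `S₁ = [P, k]` and
`S₂ = [P, [P, k]]`. -/
theorem abs_inner_commutator_le_of_hasCommutator {P : H →ₗ.[ℂ] H} (hP : IsSelfAdjoint P)
    (hP0 : ∀ x y, (x, y) ∈ P.graph → 0 ≤ (inner ℂ x y).re) {k S₁ S₂ : H →L[ℂ] H} (hk : 0 ≤ k)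
    (h₁ : HasCommutator P k S₁) (h₂ : HasCommutator P S₁ S₂) (x : H) {t : ℝ} (ht : 0 < t) :
    |(inner ℂ x (I • S₁ x)).re| ≤ (inner ℂ x (k x)).re / t + ‖S₂‖ * ‖x‖ ^ 2 * t := by
  obtain ⟨r, Q, hr1, hrsa, hQsa, hrQ, -, -, hcomm, hlim⟩ := exists_yosida hP hP0
  have h3 : ∀ n, |(inner ℂ (r n x) (I • S₁ (r n x))).re| ≤
      (inner ℂ x (k x)).re / t + ‖S₂‖ * ‖x‖ ^ 2 * t := fun n => by
    have e1 := hcomm n k S₁ h₁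
    have e2 := hcomm n S₁ S₂ h₂
    have e3 : Q n * (r n * S₁ * r n) - r n * S₁ * r n * Q n = r n * (r n * S₂ * r n) * r n := by
      have e4 : Q n * (r n * S₁ * r n) = r n * (Q n * S₁) * r n := by
        simp only [← mul_assoc, (hrQ n).eq]
      have e5 : r n * S₁ * r n * Q n = r n * (S₁ * Q n) * r n := by
        simp only [mul_assoc, (hrQ n).eq]
      rw [← e2, mul_sub, sub_mul, e4, e5]
    have hM : ‖Q n * (Q n * k - k * Q n) - (Q n * k - k * Q n) * Q n‖ ≤ ‖S₂‖ := by
      rw [e1, e3]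
      have h5 : ∀ B : H →L[ℂ] H, ‖r n * B * r n‖ ≤ ‖B‖ := fun B =>
        calc ‖r n * B * r n‖ ≤ ‖r n‖ * ‖B‖ * ‖r n‖ := norm_mul₃_le
          _ ≤ 1 * ‖B‖ * 1 := by gcongr <;> exact hr1 n
          _ = ‖B‖ := by ring
      exact (h5 _).trans (h5 _)
    have h6 := abs_inner_commutator_le (hQsa n) hk hM x ht
    have h7 : inner ℂ x ((I • (Q n * k - k * Q n)) x) = inner ℂ (r n x) (I • S₁ (r n x)) := by
      rw [e1]
      have : (I • (r n * S₁ * r n)) x = r n (I • S₁ (r n x)) := by rw [map_smul]; rfl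
      rw [this]
      exact ((ContinuousLinearMap.isSelfAdjoint_iff_isSymmetric.mp (hrsa n)) _ _).symm
    rwa [h7] at h6
  have hl : Tendsto (fun n => |(inner ℂ (r n x) (I • S₁ (r n x))).re|) atTop
      (𝓝 |(inner ℂ x (I • S₁ x)).re|) :=
    ((continuous_re.tendsto _).comp ((hlim x).inner
      (((S₁.continuous.tendsto _).comp (hlim x)).const_smul I))).abs
  exact le_of_tendsto' hl h3

/-! ### From the commutator with `|D|` to the commutator with `D` -/

/-- The conjugates of `D` and `|D|` by `e^{iτk}` are compared as `τ → ∞`: the expectation of `D`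
grows like `τ ⟨x, i [D, k] x⟩` when `[D, k]` commutes with `k`, while that of `|D|` has its
derivative bounded by the estimate for `[|D|, k]`, which is constant along the flow of `k`. -/
theorem IsAbs.abs_inner_comm_le {D P : H →ₗ.[ℂ] H} (hD : IsSelfAdjoint D) (h : IsAbs D P)
    {k d S₁ S₂ : H →L[ℂ] H} (hk : 0 ≤ k) (hd : HasCommutator D k d) (hdk : Commute d k)
    (h₁ : HasCommutator P k S₁) (h₂ : HasCommutator P S₁ S₂) (x : H) {t : ℝ} (ht : 0 < t) :
    |(inner ℂ x (I • d x)).re| ≤ (inner ℂ x (k x)).re / t + ‖S₂‖ * ‖x‖ ^ 2 * t := by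
  have hksa : IsSelfAdjoint k := IsSelfAdjoint.of_nonneg hk
  have hksym := ContinuousLinearMap.isSelfAdjoint_iff_isSymmetric.mp hksa
  -- It is enough to treat `x` in the domain of `|D|`.
  refine isClosed_property (p := fun x : H => |(inner ℂ x (I • d x)).re| ≤
      (inner ℂ x (k x)).re / t + ‖S₂‖ * ‖x‖ ^ 2 * t) (h.1.dense_domain.denseRange_val)
    (isClosed_le (by fun_prop) (by fun_prop)) ?_ x
  clear x
  rintro ⟨x, hx⟩
  have hxp := P.mem_graph ⟨x, hx⟩
  generalize P ⟨x, hx⟩ = p at hxp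
  change (x, p) ∈ P.graph at hxp
  change |(inner ℂ x (I • d x)).re| ≤ (inner ℂ x (k x)).re / t + ‖S₂‖ * ‖x‖ ^ 2 * t
  obtain ⟨q, hxq, -⟩ := h.exists_mem_graph hD hxp
  set c := (inner ℂ x (k x)).re / t + ‖S₂‖ * ‖x‖ ^ 2 * t with hc
  -- The flow of `k` on triples `(x, |D| x, D x)`.
  let f1 := ContinuousLinearMap.fst ℂ H (H × H)
  let f2 := (ContinuousLinearMap.fst ℂ H H).comp (ContinuousLinearMap.snd ℂ H (H × H))
  let f3 := (ContinuousLinearMap.snd ℂ H H).comp (ContinuousLinearMap.snd ℂ H (H × H))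
  let K : H × H × H →L[ℂ] H × H × H :=
    (k.comp f1).prod ((k.comp f2 + S₁.comp f1).prod (k.comp f3 + d.comp f1))
  let G : Submodule ℂ (H × H × H) :=
    P.graph.comap (f1.prod f2).toLinearMap ⊓ D.graph.comap (f1.prod f3).toLinearMap
  have hG : IsClosed (G : Set (H × H × H)) :=
    ((isClosed_graph h.1).preimage (f1.prod f2).continuous).inter
      ((isClosed_graph hD).preimage (f1.prod f3).continuous)
  obtain ⟨γ, hγ0, hγG, hγ⟩ := exists_flow K G hG
    (fun z hz => ⟨h₁ _ _ hz.1, hd _ _ hz.2⟩) (z := (x, p, q)) ⟨hxp, hxq⟩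
  have hcomp : ∀ (f : H × H × H →L[ℂ] H) τ, HasDerivAt (fun τ => f (γ τ)) (f (I • K (γ τ))) τ :=
    fun f τ => (f.restrictScalars ℝ).hasFDerivAt.comp_hasDerivAt τ (hγ τ)
  set η : ℝ → H := fun τ => (γ τ).1 with hηdef
  have hη0 : η 0 = x := congrArg Prod.fst hγ0
  have hη : ∀ τ, HasDerivAt η (I • k (η τ)) τ := fun τ => hcomp f1 τ
  have hp : ∀ τ, HasDerivAt (fun τ => (γ τ).2.1) (I • (k (γ τ).2.1 + S₁ (η τ))) τ :=
    fun τ => hcomp f2 τ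
  have hq : ∀ τ, HasDerivAt (fun τ => (γ τ).2.2) (I • (k (γ τ).2.2 + d (η τ))) τ :=
    fun τ => hcomp f3 τ
  have hpair : ∀ (ζ : ℝ → H) (S : H →L[ℂ] H),
      (∀ τ, HasDerivAt ζ (I • (k (ζ τ) + S (η τ))) τ) → ∀ τ,
      HasDerivAt (fun τ => (inner ℂ (η τ) (ζ τ)).re) (inner ℂ (η τ) (I • S (η τ))).re τ := by
    intro ζ S hζ τ
    have e1 := (hη τ).inner ℂ (hζ τ)
    have e2 : inner ℂ (k (η τ)) (ζ τ) = inner ℂ (η τ) (k (ζ τ)) := hksym _ _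
    refine (reCLM.hasFDerivAt.comp_hasDerivAt τ e1).congr_deriv ?_
    rw [reCLM_apply]
    congr 1
    rw [smul_add, inner_add_right, inner_smul_left, e2, inner_smul_right, conj_I]
    ring
  -- The constant `c` bounds the derivative of `⟨η, |D| η⟩`.
  have hb : ∀ τ, (inner ℂ (η τ) (I • S₁ (η τ))).re ≤ c := fun τ => by
    have e1 := (le_abs_self _).trans (abs_inner_commutator_le_of_hasCommutator h.1
      (fun _ _ => h.inner_graph_nonneg) hk h₁ h₂ (η τ) ht)
    rwa [inner_flow_eq hksa (Commute.refl k) hη, norm_flow_eq hksa hη, hη0] at e1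
  have hp_le : ∀ τ, 0 ≤ τ → (inner ℂ (η τ) (γ τ).2.1).re ≤ (inner ℂ x p).re + τ * c := by
    intro τ hτ
    have e1 := fun s => hpair _ _ hp s
    have e2 := image_le_of_deriv_right_le_deriv_boundary (a := 0) (b := τ)
      (B := fun s => (inner ℂ x p).re + s * c) (B' := fun _ => c)
      (fun s _ => (e1 s).continuousAt.continuousWithinAt)
      (fun s _ => (e1 s).hasDerivWithinAt) (by simp [hη0, hγ0]) (by fun_prop)
      (fun s _ => by simpa using
        (((hasDerivAt_id s).mul_const c).const_add (inner ℂ x p).re).hasDerivWithinAt)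
      (fun s _ => hb s)
    exact e2 (Set.right_mem_Icc.mpr hτ)
  -- The derivative of `⟨η, D η⟩` is constant.
  set ω := (inner ℂ x (I • d x)).re with hω
  have hq_eq : ∀ τ, (inner ℂ (η τ) (γ τ).2.2).re = (inner ℂ x q).re + τ * ω := by
    intro τ
    have e1 : ∀ s, HasDerivAt (fun s => (inner ℂ (η s) (γ s).2.2).re - s * ω) 0 s := fun s => by
      have e3 : inner ℂ (η s) ((I • d) (η s)) = inner ℂ (η 0) ((I • d) (η 0)) :=
        inner_flow_eq hksa (hdk.smul_left I) hη s
      refine ((hpair _ _ hq s).sub ((hasDerivAt_id s).mul_const ω)).congr_deriv ?_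
      rw [hη0] at e3
      have e4 : (inner ℂ (η s) (I • d (η s))).re = ω := congrArg re e3
      rw [e4]; ring
    have e2 := is_const_of_deriv_eq_zero (fun s => (e1 s).differentiableAt)
      (fun s => (e1 s).deriv) τ 0
    simp only [hη0, hγ0, zero_mul, sub_zero] at e2
    linarith
  have hle : ∀ τ, 0 ≤ τ → |(inner ℂ x q).re + τ * ω| ≤ (inner ℂ x p).re + τ * c := by
    intro τ hτ
    obtain ⟨q', h1, h2⟩ := h.exists_mem_graph hD (hγG τ).1
    have h3 : (γ τ).2.2 = q' := eq_of_mem_graph (hγG τ).2 h1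
    rw [← hq_eq, h3]
    exact h2.trans (hp_le τ hτ)
  -- Compare the slopes of the two affine bounds as `τ → ∞`.
  have hlin : ∀ a b u v : ℝ, (∀ τ, 0 ≤ τ → a + τ * u ≤ b + τ * v) → u ≤ v := by
    intro a b u v huv
    by_contra hlt
    push Not at hlt
    have h1 : 0 < u - v := sub_pos.mpr hlt
    have h2 := huv ((|b - a| + 1) / (u - v)) (by positivity)
    have h3 : (|b - a| + 1) / (u - v) * (u - v) = |b - a| + 1 := div_mul_cancel₀ _ h1.ne'
    have h4 := le_abs_self (b - a)
    nlinarith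
  rw [abs_le]
  constructor
  · have := hlin (-(inner ℂ x q).re) (inner ℂ x p).re (-ω) c fun τ hτ => by
      have := (abs_le.mp (hle τ hτ)).1
      linarith
    linarith
  · exact hlin (inner ℂ x q).re (inner ℂ x p).re ω c fun τ hτ => (abs_le.mp (hle τ hτ)).2

/-! ### The smooth domain -/

/-- The smooth domain of a self-adjoint operator `D` is dense. With `R = (1 + D²)⁻¹`, it contains
the range of `f(R)` for every continuous function `f` which vanishes near `0`, since `f(R)` is then
divisible by all powers of `R`; and `f(R) R` is close to `R`, which has dense range, if `f` is `1`
outside a small neighbourhood of `0`. -/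
theorem dense_smoothDomain {D : H →ₗ.[ℂ] H} (hD : IsSelfAdjoint D) :
    Dense (smoothDomain D : Set H) := by
  obtain ⟨R, hR0, -, hR⟩ := exists_resolvent hD
  obtain ⟨Y, -, hYR, -, hY⟩ := exists_mul_resolvent hD hR0
    fun w => (hR (R w) (w - R w)).mpr ⟨w, rfl, rfl⟩
  have hRsa : IsSelfAdjoint R := IsSelfAdjoint.of_nonneg hR0
  have hRsym := ContinuousLinearMap.isSelfAdjoint_iff_isSymmetric.mp hRsa
  have hpow : ∀ m w, (R ^ m) w ∈ powDomain D m := by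
    intro m
    induction m with
    | zero => intro w; trivial
    | succ m ih =>
      intro w
      refine mem_powDomain_succ.mpr ⟨Y ((R ^ m) w), ?_, ?_⟩
      · rw [pow_succ']; exact (hY _).1
      · have : Y ((R ^ m) w) = (R ^ m) (Y w) := DFunLike.congr_fun (hYR.pow_right m).eq w
        rw [this]; exact ih _
  have hinj : ∀ x, R x = 0 → x = 0 := by
    intro x hx
    have h1 := hY x
    rw [hx, sub_zero] at h1
    have h2 : Y x = 0 := D.graph_fst_eq_zero_snd h1.1 rfl
    rw [h2] at h1
    exact D.graph_fst_eq_zero_snd h1.2 rfl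
  rw [Submodule.dense_iff_topologicalClosure_eq_top, Submodule.topologicalClosure_eq_top_iff,
    Submodule.eq_bot_iff]
  intro x hx
  rw [Submodule.mem_orthogonal'] at hx
  refine hinj x (ext_inner_right ℂ fun y => ?_)
  rw [inner_zero_left, ← norm_eq_zero]
  have hsym : inner ℂ (R x) y = inner ℂ x (R y) := hRsym x y
  rw [hsym]
  refine le_antisymm (le_of_forall_pos_le_add fun ε hε => ?_) (norm_nonneg _)
  rw [zero_add]
  set e : ℝ := ε / (2 * (‖x‖ * ‖y‖ + 1)) with he
  have he0 : 0 < e := by positivity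
  let f : ℝ → ℝ := fun u => min 1 (max 0 (u / e - 1))
  have hfc : Continuous f := by fun_prop
  have hmem : ∀ w, cfc f R w ∈ smoothDomain D := by
    intro w
    rw [smoothDomain, Submodule.mem_iInf]
    intro m
    let g : ℝ → ℝ := fun u => f u / (max u e) ^ m
    have hg : Continuous g := hfc.div ((continuous_id.max continuous_const).pow m)
      fun u => (pow_pos (lt_of_lt_of_le he0 (le_max_right _ _)) m).ne'
    have hfg : cfc f R = R ^ m * cfc g R := by
      rw [← cfc_pow_id (R := ℝ) R m, ← cfc_mul _ _ R (by fun_prop) hg.continuousOn]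
      refine cfc_congr fun u _ => ?_
      simp only [g]
      rcases le_or_gt u e with hu | hu
      · have : f u = 0 := by
          simp only [f]
          have : u / e - 1 ≤ 0 := by rw [sub_nonpos, div_le_one he0]; exact hu
          rw [max_eq_left this]; simp
        rw [this]; simp
      · rw [max_eq_left hu.le]
        have : u ^ m ≠ 0 := (pow_pos (he0.trans hu) m).ne'
        field_simp
    rw [hfg]
    exact hpow m _
  have hclose : ‖R - cfc f R * R‖ ≤ 2 * e := by
    have h1 : R - cfc f R * R = cfc (fun u : ℝ => u - f u * u) R := by
      rw [cfc_sub _ _ R (by fun_prop) (by fun_prop), cfc_mul _ _ R (by fun_prop) (by fun_prop),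
        cfc_id' ℝ R]
    rw [h1]
    refine norm_cfc_le (by positivity) fun u hu => ?_
    have hu0 : 0 ≤ u := spectrum_nonneg_of_nonneg hR0 hu
    have hf0 : 0 ≤ f u := le_min zero_le_one (le_max_left _ _)
    have hf1 : f u ≤ 1 := min_le_left _ _
    rw [Real.norm_eq_abs, abs_of_nonneg (by nlinarith)]
    rcases le_or_gt u (2 * e) with hu | hu
    · nlinarith
    · have : f u = 1 := by
        simp only [f]
        have : 1 ≤ u / e - 1 := by rw [le_sub_iff_add_le, le_div_iff₀ he0]; linarith
        rw [max_eq_right (zero_le_one.trans this), min_eq_left this]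
      rw [this]; linarith
  have h1 : inner ℂ x (R y) = inner ℂ x ((R - cfc f R * R) y) := by
    rw [sub_apply, inner_sub_right]
    have : inner ℂ x ((cfc f R * R) y) = 0 := hx _ (hmem (R y))
    rw [this, sub_zero]
  rw [h1]
  calc ‖inner ℂ x ((R - cfc f R * R) y)‖ ≤ ‖x‖ * (2 * e * ‖y‖) :=
        (norm_inner_le_norm _ _).trans (by
          gcongr; exact ContinuousLinearMap.le_of_opNorm_le _ hclose _)
    _ = ε * (‖x‖ * ‖y‖ / (‖x‖ * ‖y‖ + 1)) := by rw [he]; field_simp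
    _ ≤ ε * 1 := by
        gcongr
        rw [div_le_one (by positivity)]; linarith
    _ = ε := mul_one ε

/-! ### The bounded operators `[D, a]` -/

/-- The factorization `W² - N² = (W + N) (W - N)` for commuting `W` and `N`. -/
theorem norm_apply_le_of_nonneg {W N : H →L[ℂ] H} (hWsa : IsSelfAdjoint W) (hNsa : IsSelfAdjoint N)
    (hWN : Commute W N) (h1 : 0 ≤ W + N) (h2 : 0 ≤ W - N) (x : H) : ‖N x‖ ≤ ‖W x‖ := by
  have hc : Commute (W + N) (W - N) :=
    ((Commute.refl W).sub_right hWN).add_left (hWN.symm.sub_right (Commute.refl N))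
  have h3 := (ContinuousLinearMap.nonneg_iff_isPositive _).mp (hc.mul_nonneg h1 h2)
  have h4 := h3.re_inner_nonneg_right x
  have h5 : (W + N) * (W - N) = W * W - N * N := by
    rw [add_mul, mul_sub, mul_sub, hWN.eq]; abel
  have h6 : ∀ {B : H →L[ℂ] H}, IsSelfAdjoint B → inner ℂ x ((B * B) x) = inner ℂ (B x) (B x) :=
    fun hB => ((ContinuousLinearMap.isSelfAdjoint_iff_isSymmetric.mp hB) x _).symm
  rw [h5, sub_apply, inner_sub_right, h6 hWsa, h6 hNsa, map_sub, inner_self_eq_norm_sq,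
    inner_self_eq_norm_sq] at h4
  exact le_of_sq_le_sq (by linarith) (norm_nonneg _)

namespace SpectralTriple

variable (T : SpectralTriple H)

theorem hasCommutator_d (a : T.A) : HasCommutator T.D a (T.d a) := by
  obtain ⟨S, hS⟩ := T.bounded_comm a a.2
  rw [d, hS.comm_eq T.selfAdjoint.dense_domain]
  exact hS

variable {T} in
theorem d_eq_of_hasCommutator {a : T.A} {S : H →L[ℂ] H} (h : HasCommutator T.D a S) :
    T.d a = S := h.comm_eq T.selfAdjoint.dense_domain

theorem d_add (a b : T.A) : T.d (a + b) = T.d a + T.d b := by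
  refine d_eq_of_hasCommutator fun ξ η h => ?_
  have h1 := T.D.graph.add_mem (T.hasCommutator_d a ξ η h) (T.hasCommutator_d b ξ η h)
  convert! h1 using 2
  exact add_add_add_comm _ _ _ _

theorem d_smul (c : ℂ) (a : T.A) : T.d (c • a) = c • T.d a := by
  refine d_eq_of_hasCommutator fun ξ η h => ?_
  have h1 := T.D.graph.smul_mem c (T.hasCommutator_d a ξ η h)
  convert! h1 using 2
  change c • (a : H →L[ℂ] H) η + c • T.d a ξ = _
  exact (smul_add _ _ _).symm

theorem d_mul (a b : T.A) : T.d (a * b) = T.d a * (b : H →L[ℂ] H) + (a : H →L[ℂ] H) * T.d b := by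
  refine d_eq_of_hasCommutator fun ξ η h => ?_
  have h1 := T.hasCommutator_d a _ _ (T.hasCommutator_d b ξ η h)
  convert! h1 using 2
  rw [map_add]
  change (a : H →L[ℂ] H) ((b : H →L[ℂ] H) η) +
    (T.d a ((b : H →L[ℂ] H) ξ) + (a : H →L[ℂ] H) (T.d b ξ)) = _
  abel

theorem d_one : T.d 1 = 0 := by
  refine d_eq_of_hasCommutator fun ξ η h => ?_
  simpa using h

theorem d_smul_one_sub (c : ℂ) (a : T.A) : T.d (c • 1 - a) = -T.d a := by
  rw [sub_eq_add_neg, ← neg_one_smul ℂ a, d_add, d_smul, d_smul, d_one, smul_zero, zero_add,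
    neg_one_smul]

theorem isSelfAdjoint_I_smul_d {h : T.A} (hh : IsSelfAdjoint h) : IsSelfAdjoint (I • T.d h) := by
  have hsa : IsSelfAdjoint (h : H →L[ℂ] H) := congrArg Subtype.val hh
  have hsym : ∀ x y : H, inner ℂ ((h : H →L[ℂ] H) x) y = inner ℂ x ((h : H →L[ℂ] H) y) :=
    ContinuousLinearMap.isSelfAdjoint_iff_isSymmetric.mp hsa
  have hdom : ∀ x y : T.D.domain, inner ℂ (T.d h x) (y : H) = -inner ℂ (x : H) (T.d h y) := by
    intro x y
    have hx := T.D.mem_graph x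
    have hy := T.D.mem_graph y
    have h1 := inner_graph_comm T.selfAdjoint (T.hasCommutator_d h _ _ hx) hy
    have h2 := inner_graph_comm T.selfAdjoint hx (T.hasCommutator_d h _ _ hy)
    rw [inner_add_left, hsym] at h1
    rw [inner_add_right, hsym] at *
    linear_combination h1 - h2
  have hall : ∀ x y : H, inner ℂ (T.d h x) y = -inner ℂ x (T.d h y) := by
    intro x y
    refine isClosed_property2 (p := fun x y : H => inner ℂ (T.d h x) y = -inner ℂ x (T.d h y))
      T.selfAdjoint.dense_domain.denseRange_val (isClosed_eq (by fun_prop) (by fun_prop)) ?_ x y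
    exact hdom
  rw [ContinuousLinearMap.isSelfAdjoint_iff_isSymmetric]
  intro x y
  change inner ℂ (I • T.d h x) y = inner ℂ x (I • T.d h y)
  rw [inner_smul_left, inner_smul_right, hall, conj_I]
  ring

variable {T}

/-- The commutator of `D` with a positive `k ∈ A` is small where `k` is small: one has
`± i [D, k] ≤ M t + k / t` for all `t > 0`. -/
theorem exists_commutator_bound (hreg : T.IsRegular) (hone : T.OrderOne) {k : T.A}
    (hk : 0 ≤ (k : H →L[ℂ] H)) :
    ∃ M : ℝ, 0 ≤ M ∧ ∀ t : ℝ, 0 < t →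
      0 ≤ ((((M * t : ℝ) : ℂ) • 1 + ((t⁻¹ : ℝ) : ℂ) • k : T.A) : H →L[ℂ] H) + I • T.d k ∧
      0 ≤ ((((M * t : ℝ) : ℂ) • 1 + ((t⁻¹ : ℝ) : ℂ) • k : T.A) : H →L[ℂ] H) - I • T.d k := by
  obtain ⟨S₁, h₁, S₂, h₂, -⟩ := (hreg k 2).1
  have hksa : IsSelfAdjoint k := Subtype.ext (IsSelfAdjoint.of_nonneg hk)
  have hNsa := T.isSelfAdjoint_I_smul_d hksa
  refine ⟨‖S₂‖, norm_nonneg _, fun t ht => ?_⟩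
  set W : H →L[ℂ] H :=
    ((((‖S₂‖ * t : ℝ) : ℂ) • 1 + ((t⁻¹ : ℝ) : ℂ) • k : T.A) : H →L[ℂ] H) with hW
  have hWx : ∀ x, W x = ((‖S₂‖ * t : ℝ) : ℂ) • x + ((t⁻¹ : ℝ) : ℂ) • (k : H →L[ℂ] H) x :=
    fun x => rfl
  have hWsa : IsSelfAdjoint W :=
    ((isSelfAdjoint_iff.mpr (conj_ofReal _)).smul (IsSelfAdjoint.one _)).add
      ((isSelfAdjoint_iff.mpr (conj_ofReal _)).smul (IsSelfAdjoint.of_nonneg hk))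
  have hest := fun x => (absOp_spec T.selfAdjoint).abs_inner_comm_le T.selfAdjoint hk
    (T.hasCommutator_d k) (hone k k) h₁ h₂ x ht
  have hWin : ∀ x, (inner ℂ x (W x)).re =
      (inner ℂ x ((k : H →L[ℂ] H) x)).re / t + ‖S₂‖ * ‖x‖ ^ 2 * t := by
    intro x
    rw [hWx, inner_add_right, inner_smul_right, inner_smul_right, add_re, re_ofReal_mul,
      re_ofReal_mul]
    have : (inner ℂ x x).re = ‖x‖ ^ 2 := inner_self_eq_norm_sq (𝕜 := ℂ) x
    rw [this]
    field_simp
    ring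
  have key : ∀ B : H →L[ℂ] H, IsSelfAdjoint B → (∀ x, 0 ≤ (inner ℂ x (B x)).re) → 0 ≤ B := by
    intro B hB h
    rw [ContinuousLinearMap.nonneg_iff_isPositive, ContinuousLinearMap.isPositive_def]
    refine ⟨ContinuousLinearMap.isSelfAdjoint_iff_isSymmetric.mp hB, fun x => ?_⟩
    rw [ContinuousLinearMap.reApplyInnerSelf_apply, ← inner_conj_symm, RCLike.conj_re]
    exact h x
  constructor
  · refine key _ (hWsa.add hNsa) fun x => ?_
    have h3 := (abs_le.mp (hest x)).1
    rw [add_apply, inner_add_right, add_re, hWin]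
    change 0 ≤ _ + (inner ℂ x (I • T.d k x)).re
    linarith
  · refine key _ (hWsa.sub hNsa) fun x => ?_
    have h3 := (abs_le.mp (hest x)).2
    rw [sub_apply, inner_sub_right, sub_re, hWin]
    change 0 ≤ _ - (inner ℂ x (I • T.d k x)).re
    linarith

/-! ### Characters -/

theorem norm_character_le (φ : T.Spec) (a : T.A) : ‖φ a‖ ≤ ‖a‖ := by
  let f : T.A →L[ℂ] ℂ := WeakDual.toStrongDual (φ : WeakDual ℂ T.A)
  have hf : ∀ b, φ b = f b := fun b => rfl
  by_contra hlt
  push Not at hlt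
  have h0 : 0 < ‖φ a‖ := (norm_nonneg _).trans_lt hlt
  -- Otherwise the powers of `a / φ a` tend to `0`, while `φ` is `1` on each of them.
  have h1 : ∀ n : ℕ, ‖φ a‖ ^ (n + 1) ≤ ‖f‖ * ‖a‖ ^ (n + 1) := fun n => by
    rw [← norm_pow, ← map_pow, hf]
    refine (f.le_opNorm _).trans ?_
    gcongr
    exact norm_pow_le' a n.succ_pos
  have h2 : ∀ n : ℕ, 1 ≤ ‖f‖ * (‖a‖ / ‖φ a‖) ^ (n + 1) := fun n => by
    rw [div_pow, ← mul_div_assoc, le_div_iff₀ (by positivity), one_mul]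
    exact h1 n
  have h3 : Tendsto (fun n : ℕ => ‖f‖ * (‖a‖ / ‖φ a‖) ^ (n + 1)) atTop (𝓝 (‖f‖ * 0)) :=
    ((tendsto_pow_atTop_nhds_zero_of_lt_one (by positivity)
      ((div_lt_one h0).mpr hlt)).comp (tendsto_add_atTop_nat 1)).const_mul _
  have h4 := ge_of_tendsto' h3 h2
  rw [mul_zero] at h4
  exact absurd h4 (by norm_num)

/-- A character is real on self-adjoint elements: if `φ h = α + i β` then
`β + s ≤ |φ (h + i s)| ≤ (‖h‖² + s²)^(1/2)` for all real `s`. -/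
theorem character_im_eq_zero (φ : T.Spec) {h : T.A} (hh : IsSelfAdjoint h) : (φ h).im = 0 := by
  have h1 : ∀ s : ℝ, ((φ h).im + s) ^ 2 ≤ ‖h‖ ^ 2 + s ^ 2 := by
    intro s
    set x : T.A := h + ((s : ℂ) * I) • 1 with hx
    have e1 : φ x = φ h + (s : ℂ) * I := by
      rw [hx, map_add, map_smul, map_one, smul_eq_mul, mul_one]
    have e2 : star x * x = h * h + ((s ^ 2 : ℝ) : ℂ) • 1 := by
      rw [hx, star_add, hh.star_eq, star_smul, star_one, RCLike.star_def, map_mul, conj_ofReal,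
        conj_I, add_mul, mul_add, mul_add, smul_mul_smul_comm, mul_smul_comm, smul_mul_assoc,
        mul_one, one_mul]
      have e3 : (s : ℂ) * -I * (s * I) = ((s ^ 2 : ℝ) : ℂ) := by
        push_cast
        linear_combination (-(s : ℂ) ^ 2) * I_mul_I
      rw [e3, mul_neg, neg_smul]
      abel
    have e4 : ‖x‖ ^ 2 ≤ ‖h‖ ^ 2 + s ^ 2 := by
      have e5 : ‖x‖ * ‖x‖ = ‖star x * x‖ := CStarRing.norm_star_mul_self.symm
      have e6 : ‖(1 : T.A)‖ ≤ 1 := ContinuousLinearMap.norm_id_le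
      rw [sq, e5, e2]
      refine (norm_add_le _ _).trans (add_le_add ((norm_mul_le _ _).trans_eq (sq _).symm) ?_)
      rw [norm_smul, norm_real, Real.norm_eq_abs, abs_of_nonneg (sq_nonneg s)]
      exact mul_le_of_le_one_right (sq_nonneg s) e6
    have e7 : (φ x).im = (φ h).im + s := by rw [e1]; simp
    rw [← e7]
    refine le_trans ?_ e4
    rw [← sq_abs]
    exact pow_le_pow_left₀ (abs_nonneg _) ((abs_im_le_norm _).trans (norm_character_le φ x)) 2
  by_contra hβ
  have h2 := h1 (‖h‖ ^ 2 / (2 * (φ h).im))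
  have h3 : 2 * (φ h).im * (‖h‖ ^ 2 / (2 * (φ h).im)) = ‖h‖ ^ 2 := by field_simp
  have h4 : 0 < (φ h).im ^ 2 := by positivity
  nlinarith

theorem character_re_nonneg (φ : T.Spec) {q : T.A} (hq : 0 ≤ (q : H →L[ℂ] H)) :
    0 ≤ (φ q).re := by
  set c := ‖q‖
  have h1 : ‖((c : ℂ) • 1 - q : T.A)‖ ≤ c := by
    have h2 : 0 ≤ (c : ℂ) • 1 - (q : H →L[ℂ] H) := by
      rw [sub_nonneg]
      have h3 := IsSelfAdjoint.le_algebraMap_norm_self (IsSelfAdjoint.of_nonneg hq)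
      rw [Algebra.algebraMap_eq_smul_one] at h3
      exact h3
    change ‖(c : ℂ) • 1 - (q : H →L[ℂ] H)‖ ≤ c
    rw [CStarAlgebra.norm_le_iff_le_algebraMap _ (norm_nonneg _) h2,
      Algebra.algebraMap_eq_smul_one]
    exact sub_le_self _ hq
  have h2 := (re_le_norm _).trans ((norm_character_le φ _).trans h1)
  rw [map_sub, map_smul, map_one, sub_re, smul_eq_mul, mul_one, ofReal_re] at h2
  linarith

/-- The Gelfand transform is isometric on `A`: the characters of the closure of `A`, a commutative
`C*`-algebra, restrict to characters of `A`. -/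
theorem exists_character_norm_eq [Nontrivial H] (hcomm : T.IsCommutative) (a : T.A) :
    ∃ φ : T.Spec, ‖φ a‖ = ‖a‖ := by
  let C := T.A.topologicalClosure
  have : IsClosed (C : Set (H →L[ℂ] H)) := T.A.isClosed_topologicalClosure
  let _ : CommRing C := T.A.commRingTopologicalClosure fun x y => Subtype.ext (hcomm x x.2 y y.2)
  let _ : CommCStarAlgebra C :=
    { (inferInstance : CStarAlgebra C) with mul_comm := mul_comm }
  let ι : T.A →ₐ[ℂ] C := (StarSubalgebra.inclusion T.A.le_topologicalClosure).toAlgHom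
  have hι : Continuous ι := (StarSubalgebra.isEmbedding_inclusion _).continuous
  obtain ⟨z, hz, hza⟩ := spectrum.exists_nnnorm_eq_spectralRadius (ι a)
  rw [IsStarNormal.spectralRadius_eq_nnnorm] at hza
  obtain ⟨ψ, hψ⟩ := WeakDual.CharacterSpace.mem_spectrum_iff_exists.mp hz
  let f : WeakDual ℂ T.A := StrongDual.toWeakDual
    ((WeakDual.toStrongDual (ψ : WeakDual ℂ C)).comp ⟨ι.toLinearMap, hι⟩)
  have hf : ∀ x, f x = ψ (ι x) := fun x => rfl
  refine ⟨⟨f, fun h0 => ?_, fun x y => ?_⟩, ?_⟩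
  · have h1 : f 1 = 0 := by rw [h0]; rfl
    rw [hf, map_one, map_one] at h1
    exact one_ne_zero h1
  · rw [hf, hf, hf, map_mul, map_mul]
  · change ‖f a‖ = ‖a‖
    rw [hf, hψ]
    exact congrArg NNReal.toReal (ENNReal.coe_injective hza)

theorem nontrivial_of_character (χ : T.Spec) : Nontrivial H := by
  by_contra hH
  rw [not_nontrivial_iff_subsingleton] at hH
  have h1 : (1 : T.A) = 0 := Subtype.ext (ContinuousLinearMap.ext fun x => Subsingleton.elim _ _)
  have h2 := map_one χ
  rw [h1, map_zero] at h2
  exact zero_ne_one h2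

theorem nonneg_smul_one_sub {h : T.A} (hh : IsSelfAdjoint h) {c : ℝ} (hc : ‖h‖ ≤ c) :
    0 ≤ (((c : ℂ) • 1 - h : T.A) : H →L[ℂ] H) := by
  have hsa : IsSelfAdjoint (h : H →L[ℂ] H) := congrArg Subtype.val hh
  have h1 := IsSelfAdjoint.le_algebraMap_norm_self hsa
  have h2 : algebraMap ℝ (H →L[ℂ] H) ‖(h : H →L[ℂ] H)‖ ≤ algebraMap ℝ (H →L[ℂ] H) c :=
    algebraMap_mono _ hc
  have h3 := h1.trans h2
  rw [Algebra.algebraMap_eq_smul_one] at h3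
  exact sub_nonneg.mpr h3

/-! ### Commutators at a point where `|h|` is maximal -/

/-- By the Gelfand transform, `‖k bₙ‖` is at most `sup ‖bₙ‖` times the maximum of `|k|` on the
support of `bₙ`. -/
theorem tendsto_mul_of_apply_eq_zero (hcomm : T.IsCommutative) {χ : T.Spec} {k : T.A}
    (hχ : χ k = 0) {b : ℕ → T.A} {C : ℝ} (hC : ∀ n, ‖b n‖ ≤ C)
    (hb : ∀ U ∈ 𝓝 χ, ∀ᶠ n in atTop, T.supp (b n) ⊆ U) :
    Tendsto (fun n => ‖k * b n‖) atTop (𝓝 0) := by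
  have := nontrivial_of_character χ
  have hC0 : 0 ≤ C := (norm_nonneg _).trans (hC 0)
  rw [Metric.tendsto_atTop']
  intro ε hε
  have hcont : Continuous fun φ : T.Spec => ‖φ k‖ :=
    ((WeakDual.eval_continuous k).comp continuous_subtype_val).norm
  have hU : {φ : T.Spec | ‖φ k‖ < ε / (C + 1)} ∈ 𝓝 χ :=
    (isOpen_lt hcont continuous_const).mem_nhds (by
      rw [Set.mem_ofPred_eq, hχ, norm_zero]; positivity)
  obtain ⟨N, hN⟩ := eventually_atTop.mp (hb _ hU)
  refine ⟨N, fun n hn => ?_⟩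
  obtain ⟨φ, hφ⟩ := exists_character_norm_eq hcomm (k * b n)
  rw [dist_zero_right, norm_norm, ← hφ, map_mul, norm_mul]
  by_cases h0 : φ (b n) = 0
  · rw [h0, norm_zero, mul_zero]; exact hε
  · have h1 : ‖φ k‖ < ε / (C + 1) := hN n hn.le (subset_tsupport _ h0)
    have h2 : ‖φ (b n)‖ ≤ C := (norm_character_le φ _).trans (hC n)
    calc ‖φ k‖ * ‖φ (b n)‖ ≤ ε / (C + 1) * C := by gcongr
      _ = ε * (C / (C + 1)) := by ring
      _ < ε * 1 := by
        gcongr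
        rw [div_lt_one (by positivity)]; linarith
      _ = ε := mul_one ε

theorem tendsto_d_mul_of_apply_eq_zero (hcomm : T.IsCommutative) (hreg : T.IsRegular)
    (hone : T.OrderOne) {χ : T.Spec} {k : T.A} (hk : 0 ≤ (k : H →L[ℂ] H))
    (hχ : χ k = 0) {b : ℕ → T.A} {C : ℝ} (hC : ∀ n, ‖b n‖ ≤ C)
    (hb : ∀ U ∈ 𝓝 χ, ∀ᶠ n in atTop, T.supp (b n) ⊆ U) :
    Tendsto (fun n => ‖T.d k * (b n : H →L[ℂ] H)‖) atTop (𝓝 0) := by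
  obtain ⟨M, hM0, hM⟩ := exists_commutator_bound hreg hone hk
  have hC0 : 0 ≤ C := (norm_nonneg _).trans (hC 0)
  have hksa : IsSelfAdjoint k := Subtype.ext (IsSelfAdjoint.of_nonneg hk)
  -- The first term is small for small `t`; for fixed `t` the second one tends to `0`.
  have hbound : ∀ t : ℝ, 0 < t → ∀ n,
      ‖T.d k * (b n : H →L[ℂ] H)‖ ≤ M * t * C + t⁻¹ * ‖k * b n‖ := by
    intro t ht n
    set W : T.A := ((M * t : ℝ) : ℂ) • 1 + ((t⁻¹ : ℝ) : ℂ) • k with hW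
    have hWsa : IsSelfAdjoint (W : H →L[ℂ] H) := by
      have := ((IsSelfAdjoint.of_nonneg (hM t ht).1).sub (T.isSelfAdjoint_I_smul_d hksa))
      rwa [add_sub_cancel_right] at this
    have hWN : Commute (W : H →L[ℂ] H) (I • T.d k) :=
      (show Commute (W : H →L[ℂ] H) (T.d k) from (hone k W).symm).smul_right I
    have h1 : ‖T.d k * (b n : H →L[ℂ] H)‖ ≤ ‖W * b n‖ := by
      refine ContinuousLinearMap.opNorm_le_bound _ (norm_nonneg _) fun x => ?_
      have h2 := norm_apply_le_of_nonneg hWsa (T.isSelfAdjoint_I_smul_d hksa) hWN (hM t ht).1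
        (hM t ht).2 ((b n : H →L[ℂ] H) x)
      have h3 : ‖(I • T.d k) ((b n : H →L[ℂ] H) x)‖ = ‖T.d k ((b n : H →L[ℂ] H) x)‖ := by
        rw [smul_apply, norm_smul, norm_I, one_mul]
      rw [h3] at h2
      exact h2.trans (((W * b n : T.A) : H →L[ℂ] H).le_opNorm x)
    refine h1.trans ?_
    rw [hW, add_mul, smul_mul_assoc, smul_mul_assoc, one_mul]
    refine (norm_add_le _ _).trans ?_
    rw [norm_smul, norm_smul, norm_real, norm_real, Real.norm_eq_abs, Real.norm_eq_abs,
      abs_of_nonneg (by positivity : 0 ≤ M * t), abs_of_nonneg (by positivity : 0 ≤ t⁻¹)]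
    gcongr
    exact hC n
  have hlim := tendsto_mul_of_apply_eq_zero hcomm hχ hC hb
  rw [Metric.tendsto_atTop']
  intro ε hε
  set t : ℝ := ε / (2 * (M * C + 1)) with ht
  have hMC : 0 ≤ M * C := mul_nonneg hM0 hC0
  have ht0 : 0 < t := by positivity
  obtain ⟨N, hN⟩ := Metric.tendsto_atTop'.mp hlim (t * (ε / 2)) (by positivity)
  refine ⟨N, fun n hn => ?_⟩
  have h1 := hN n hn
  rw [dist_zero_right, norm_norm] at h1 ⊢
  have h2 : t⁻¹ * ‖k * b n‖ < ε / 2 := by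
    rw [inv_mul_lt_iff₀ ht0]; exact h1
  have h3 : M * t * C ≤ ε / 2 := by
    have : M * t * C = ε / 2 * (M * C / (M * C + 1)) := by rw [ht]; field_simp
    rw [this]
    exact mul_le_of_le_one_right (by positivity) ((div_le_one (by positivity)).mpr (by linarith))
  exact (hbound t ht0 n).trans_lt (by linarith)

theorem tendsto_d_mul_of_isMax (hcomm : T.IsCommutative) (hreg : T.IsRegular)
    (hone : T.OrderOne) {h : T.A} (hh : IsSelfAdjoint h) {χ : T.Spec}
    (hχ : ∀ φ : T.Spec, ‖φ h‖ ≤ ‖χ h‖) {b : ℕ → T.A} {C : ℝ} (hC : ∀ n, ‖b n‖ ≤ C)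
    (hb : ∀ U ∈ 𝓝 χ, ∀ᶠ n in atTop, T.supp (b n) ⊆ U) :
    Tendsto (fun n => ‖T.d h * (b n : H →L[ℂ] H)‖) atTop (𝓝 0) := by
  have := nontrivial_of_character χ
  obtain ⟨φ, hφ⟩ := exists_character_norm_eq hcomm h
  have hnorm : ‖χ h‖ = ‖h‖ := le_antisymm (norm_character_le χ h) (hφ ▸ hχ φ)
  have him := character_im_eq_zero χ hh
  have hre : χ h = ((χ h).re : ℂ) := Complex.ext rfl (by simp [him])
  have hpos : ∀ {g : T.A}, IsSelfAdjoint g → χ g = (‖g‖ : ℂ) →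
      Tendsto (fun n => ‖T.d g * (b n : H →L[ℂ] H)‖) atTop (𝓝 0) := by
    intro g hg hχg
    have h1 := tendsto_d_mul_of_apply_eq_zero hcomm hreg hone (χ := χ)
      (nonneg_smul_one_sub hg le_rfl)
      (by rw [map_sub, map_smul, map_one, hχg, smul_eq_mul, mul_one, sub_self]) hC hb
    simpa only [d_smul_one_sub, neg_mul, norm_neg] using h1
  rw [hre, norm_real, Real.norm_eq_abs] at hnorm
  rcases abs_choice (χ h).re with hs | hs
  · exact hpos hh (by rw [hre, ← hnorm, hs])
  · have h1 := hpos hh.neg (by rw [map_neg, norm_neg, ← hnorm, hs, hre, ofReal_neg, ofReal_re])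
    have h2 : T.d (-h) = -T.d h := by
      rw [← neg_one_smul ℂ h, d_smul, neg_one_smul]
    simpa only [h2, neg_mul, norm_neg] using h1

namespace HermitianFinite

variable (S : T.HermitianFinite)

/-! ### The derivations attached to smooth vectors -/

theorem d_mem_smoothDomain (S : T.HermitianFinite) (a : T.A) (ξ : smoothDomain T.D) :
    T.d a (ξ : H) ∈ smoothDomain T.D := by
  obtain ⟨y, hy, hys⟩ := mem_smoothDomain_iff.mp ξ.2
  obtain ⟨z, hz, hzs⟩ := mem_smoothDomain_iff.mp (S.smul_mem a ξ)
  have h1 := eq_of_mem_graph hz (T.hasCommutator_d a _ _ hy)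
  have h2 : T.d a (ξ : H) = z - (a : H →L[ℂ] H) y := by rw [h1]; abel
  rw [h2]
  exact sub_mem hzs (S.smul_mem a ⟨y, hys⟩)

theorem herm_add_right (ξ η ζ : smoothDomain T.D) :
    S.herm ξ (η + ζ) = S.herm ξ η + S.herm ξ ζ := by
  simp only [herm, map_add, Pi.add_apply, mul_add, Finset.sum_add_distrib]

theorem herm_smul_right (c : ℂ) (ξ η : smoothDomain T.D) :
    S.herm ξ (c • η) = c • S.herm ξ η := by
  simp only [herm, map_smul, Pi.smul_apply, mul_smul_comm, Finset.smul_sum]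

theorem herm_apply_right (hcomm : T.IsCommutative) (a : T.A) (ξ η : smoothDomain T.D) :
    S.herm ξ ⟨(a : H →L[ℂ] H) (η : H), S.smul_mem a η⟩ = a * S.herm ξ η := by
  simp only [herm, S.coord_smul, Finset.mul_sum]
  refine Finset.sum_congr rfl fun i _ => ?_
  rw [← mul_assoc, ← mul_assoc]
  congr 1
  exact Subtype.ext (hcomm _ (star (S.coord ξ i)).2 _ a.2)

/-- If `B ≥ 0` commutes with `A`, then `(ξ|B ξ) ≥ 0`: by absolute continuity
`⟨ζ, (ξ|B ξ) ζ⟩ = ∑ ⟨ζᵢ ξ, B ζᵢ ξ⟩` for all `ζ` in the dense subspace `H_∞`. -/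
theorem herm_nonneg (hcomm : T.IsCommutative) {B : H →L[ℂ] H} (hB : 0 ≤ B)
    (hBA : ∀ a : T.A, Commute B (a : H →L[ℂ] H)) (ξ : smoothDomain T.D)
    (hBξ : B (ξ : H) ∈ smoothDomain T.D) : 0 ≤ (S.herm ξ ⟨B (ξ : H), hBξ⟩ : H →L[ℂ] H) := by
  set q := S.herm ξ ⟨B (ξ : H), hBξ⟩ with hq
  have hmc : ∀ a b : T.A, a * b = b * a := fun a b => Subtype.ext (hcomm a a.2 b b.2)
  have hBpos := (ContinuousLinearMap.nonneg_iff_isPositive B).mp hB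
  have hterm : ∀ a : T.A, S.lam (star a * a * q) =
      inner ℂ ((a : H →L[ℂ] H) ξ) (B ((a : H →L[ℂ] H) ξ)) := by
    intro a
    have h1 := S.abs_cont (star a * a) ξ ⟨B (ξ : H), hBξ⟩
    change _ = S.lam (star a * a * q) at h1
    rw [← h1]
    change inner ℂ (ξ : H) (ContinuousLinearMap.adjoint (a : H →L[ℂ] H) ((a : H →L[ℂ] H) (B ξ))) = _
    rw [ContinuousLinearMap.adjoint_inner_right]
    congr 1
    exact (DFunLike.congr_fun (hBA a).eq (ξ : H)).symm
  have hsum : ∀ ζ : smoothDomain T.D, inner ℂ (ζ : H) ((q : H →L[ℂ] H) ζ) =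
      ∑ i, inner ℂ ((S.coord ζ i : H →L[ℂ] H) ξ) (B ((S.coord ζ i : H →L[ℂ] H) ξ)) := by
    intro ζ
    rw [S.abs_cont q ζ ζ, hmc, Finset.sum_mul, map_sum]
    exact Finset.sum_congr rfl fun i _ => hterm _
  have hall : ∀ z : H, (inner ℂ z ((q : H →L[ℂ] H) z)).im = 0 ∧
      0 ≤ (inner ℂ z ((q : H →L[ℂ] H) z)).re := by
    intro z
    have hcont : Continuous fun z : H => inner ℂ z ((q : H →L[ℂ] H) z) := by fun_prop
    refine isClosed_property (p := fun z : H => (inner ℂ z ((q : H →L[ℂ] H) z)).im = 0 ∧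
      0 ≤ (inner ℂ z ((q : H →L[ℂ] H) z)).re)
      (dense_smoothDomain T.selfAdjoint).denseRange_val
      ((isClosed_eq (continuous_im.comp hcont) continuous_const).inter
        (isClosed_le continuous_const (continuous_re.comp hcont))) (fun ζ => ?_) z
    rw [hsum ζ, im_sum, re_sum]
    constructor
    · exact Finset.sum_eq_zero fun i _ => hBpos.isSelfAdjoint.isSymmetric.im_inner_self_apply _
    · exact Finset.sum_nonneg fun i _ => hBpos.re_inner_nonneg_right _
  rw [ContinuousLinearMap.nonneg_iff_isPositive, ContinuousLinearMap.isPositive_iff_complex]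
  intro z
  obtain ⟨h1, h2⟩ := hall z
  rw [← inner_conj_symm, RCLike.conj_re]
  have h3 := conj_eq_iff_im.mpr h1
  exact ⟨(conj_eq_iff_re.mp h3).trans h3.symm, h2⟩

/-- The derivation `a ↦ i (ξ|[D, a] ξ)` of `A`. -/
def deriv (ξ : smoothDomain T.D) : T.A →ₗ[ℂ] T.A where
  toFun a := I • S.herm ξ ⟨T.d a (ξ : H), S.d_mem_smoothDomain a ξ⟩
  map_add' a b := by
    rw [← smul_add, ← herm_add_right]
    congr 3
    rw [d_add]; rfl
  map_smul' c a := by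
    have h : (⟨T.d (c • a) (ξ : H), S.d_mem_smoothDomain _ ξ⟩ : smoothDomain T.D) =
        c • ⟨T.d a (ξ : H), S.d_mem_smoothDomain a ξ⟩ :=
      Subtype.ext (DFunLike.congr_fun (T.d_smul c a) (ξ : H))
    rw [RingHom.id_apply, smul_comm c I, h, herm_smul_right]

theorem deriv_apply (ξ : smoothDomain T.D) (a : T.A) :
    S.deriv ξ a = I • S.herm ξ ⟨T.d a (ξ : H), S.d_mem_smoothDomain a ξ⟩ := rfl

theorem deriv_mul (hcomm : T.IsCommutative) (hone : T.OrderOne) (ξ : smoothDomain T.D)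
    (a b : T.A) : S.deriv ξ (a * b) = S.deriv ξ a * b + a * S.deriv ξ b := by
  have hmc : ∀ a b : T.A, a * b = b * a := fun a b => Subtype.ext (hcomm a a.2 b b.2)
  rw [hmc (S.deriv ξ a)]
  simp only [deriv_apply, mul_smul_comm]
  rw [← smul_add, ← S.herm_apply_right hcomm, ← S.herm_apply_right hcomm, ← herm_add_right]
  congr 3
  rw [d_mul, hone a b]
  rfl

/-- `(ξ|(W + c i [D, a]) ξ) = W (ξ|ξ) + c i (ξ|[D, a] ξ)`. -/
theorem herm_add_smul_d (hcomm : T.IsCommutative) (ξ : smoothDomain T.D) (W a : T.A) (c : ℂ)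
    (hmem : ((W : H →L[ℂ] H) + c • I • T.d a) (ξ : H) ∈ smoothDomain T.D) :
    S.herm ξ ⟨_, hmem⟩ = W * S.herm ξ ξ + c • S.deriv ξ a := by
  rw [deriv_apply, ← S.herm_apply_right hcomm, ← herm_smul_right, ← herm_smul_right,
    ← herm_add_right]
  rfl

theorem add_smul_d_mem (S : T.HermitianFinite) (ξ : smoothDomain T.D) (W a : T.A) (c : ℂ) :
    ((W : H →L[ℂ] H) + c • I • T.d a) (ξ : H) ∈ smoothDomain T.D :=
  add_mem (S.smul_mem W ξ)
    (Submodule.smul_mem _ c (Submodule.smul_mem _ I (S.d_mem_smoothDomain a ξ)))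

theorem nonneg_of_add_smul_d (hcomm : T.IsCommutative) (hone : T.OrderOne)
    (ξ : smoothDomain T.D) (W a : T.A) (c : ℂ) (h : 0 ≤ (W : H →L[ℂ] H) + c • I • T.d a) :
    0 ≤ ((W * S.herm ξ ξ + c • S.deriv ξ a : T.A) : H →L[ℂ] H) := by
  rw [← S.herm_add_smul_d hcomm ξ W a c (S.add_smul_d_mem ξ W a c)]
  refine S.herm_nonneg hcomm h (fun b => ?_) ξ _
  have h1 : Commute (T.d a) (b : H →L[ℂ] H) := hone a b
  have h2 : Commute (W : H →L[ℂ] H) (b : H →L[ℂ] H) := hcomm W W.2 b b.2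
  exact h2.add_left ((h1.smul_left I).smul_left c)

theorem herm_self_nonneg (hcomm : T.IsCommutative) (hone : T.OrderOne) (ξ : smoothDomain T.D) :
    0 ≤ (S.herm ξ ξ : H →L[ℂ] H) := by
  have h := S.nonneg_of_add_smul_d hcomm hone ξ 1 0 0 (by
    rw [zero_smul, add_zero]; exact zero_le_one)
  rwa [zero_smul, add_zero, one_mul] at h

/-- The element `‖[D, h]‖ (ξ|ξ) + i (ξ|[D, h] ξ)` is positive, hence self-adjoint. -/
theorem isSelfAdjoint_deriv (hcomm : T.IsCommutative) (hone : T.OrderOne)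
    (ξ : smoothDomain T.D) {h : T.A} (hh : IsSelfAdjoint h) : IsSelfAdjoint (S.deriv ξ h) := by
  set N := I • T.d h with hN
  have hNsa : IsSelfAdjoint N := T.isSelfAdjoint_I_smul_d hh
  have h1 : 0 ≤ (((‖N‖ : ℂ) • 1 : T.A) : H →L[ℂ] H) + (1 : ℂ) • I • T.d h := by
    rw [one_smul, ← hN]
    have h2 := IsSelfAdjoint.neg_algebraMap_norm_le_self hNsa
    rw [Algebra.algebraMap_eq_smul_one, neg_le_iff_add_nonneg'] at h2
    exact h2
  have h2 := IsSelfAdjoint.of_nonneg (S.nonneg_of_add_smul_d hcomm hone ξ _ h 1 h1)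
  have h3 := IsSelfAdjoint.of_nonneg (S.herm_self_nonneg hcomm hone ξ)
  have h4 : IsSelfAdjoint ((‖N‖ : ℂ) • (S.herm ξ ξ : H →L[ℂ] H)) :=
    (isSelfAdjoint_iff.mpr (conj_ofReal _)).smul h3
  have h5 := h2.sub h4
  rw [one_smul, smul_mul_assoc, one_mul] at h5
  have h6 : (((‖N‖ : ℂ) • S.herm ξ ξ + S.deriv ξ h : T.A) : H →L[ℂ] H) -
      (‖N‖ : ℂ) • (S.herm ξ ξ : H →L[ℂ] H) = S.deriv ξ h := add_sub_cancel_left _ _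
  rw [h6] at h5
  exact Subtype.ext h5

/-- The derivation vanishes at a zero of a positive element: evaluating
`(M t + k / t) (ξ|ξ) ± δ k ≥ 0` at `χ` gives `|χ (δ k)| ≤ M t χ (ξ|ξ)` for all `t > 0`. -/
theorem character_deriv_eq_zero (hcomm : T.IsCommutative) (hreg : T.IsRegular)
    (hone : T.OrderOne) (ξ : smoothDomain T.D) {k : T.A} (hk : 0 ≤ (k : H →L[ℂ] H)) {χ : T.Spec}
    (hχ : χ k = 0) : χ (S.deriv ξ k) = 0 := by
  obtain ⟨M, hM0, hM⟩ := exists_commutator_bound hreg hone hk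
  have hksa : IsSelfAdjoint k := Subtype.ext (IsSelfAdjoint.of_nonneg hk)
  refine Complex.ext ?_ (character_im_eq_zero χ (S.isSelfAdjoint_deriv hcomm hone ξ hksa))
  rw [zero_re]
  set ρ := (χ (S.herm ξ ξ)).re with hρ
  have hρ0 : 0 ≤ ρ := character_re_nonneg χ (S.herm_self_nonneg hcomm hone ξ)
  have hval : ∀ (t : ℝ) (c : ℂ),
      χ ((((M * t : ℝ) : ℂ) • 1 + ((t⁻¹ : ℝ) : ℂ) • k) * S.herm ξ ξ + c • S.deriv ξ k) =
      ((M * t : ℝ) : ℂ) * χ (S.herm ξ ξ) + c * χ (S.deriv ξ k) := by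
    intro t c
    simp only [map_add, map_mul, map_smul, map_one, hχ, smul_eq_mul, mul_zero, add_zero, mul_one]
  have hbd : ∀ t : ℝ, 0 < t → |(χ (S.deriv ξ k)).re| ≤ M * t * ρ := by
    intro t ht
    have h1 := character_re_nonneg χ (S.nonneg_of_add_smul_d hcomm hone ξ _ k 1
      (by rw [one_smul]; exact (hM t ht).1))
    have h2 := character_re_nonneg χ (S.nonneg_of_add_smul_d hcomm hone ξ _ k (-1)
      (by rw [neg_one_smul, ← sub_eq_add_neg]; exact (hM t ht).2))
    rw [hval, add_re, re_ofReal_mul] at h1 h2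
    rw [one_mul] at h1
    rw [neg_one_mul, neg_re] at h2
    rw [abs_le]
    constructor <;> linarith
  rw [← abs_eq_zero]
  refine le_antisymm (le_of_forall_pos_le_add fun ε hε => ?_) (abs_nonneg _)
  have hMρ : 0 ≤ M * ρ := mul_nonneg hM0 hρ0
  refine (hbd (ε / (M * ρ + 1)) (by positivity)).trans ?_
  have h1 : M * (ε / (M * ρ + 1)) * ρ = ε * (M * ρ / (M * ρ + 1)) := by ring
  rw [h1, zero_add]
  exact mul_le_of_le_one_right hε.le ((div_le_one (by positivity)).mpr (by linarith))

/-- At a character `χ` with `χ y = ‖y‖`, the real part of `y` is maximal, so that its derivative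
vanishes at `χ`, while the derivative of `i` times the imaginary part is purely imaginary. -/
theorem norm_le_norm_add_smul_deriv_of_apply_eq (hcomm : T.IsCommutative) (hreg : T.IsRegular)
    (hone : T.OrderOne) (ξ : smoothDomain T.D) {y : T.A} {χ : T.Spec} (hχ : χ y = (‖y‖ : ℂ))
    (t : ℝ) : ‖y‖ ≤ ‖y + (t : ℂ) • S.deriv ξ y‖ := by
  have hy := realPart_add_I_smul_imaginaryPart y
  set h : T.A := (realPart y : T.A) with hh
  set h' : T.A := (imaginaryPart y : T.A) with hh'
  have hsa : IsSelfAdjoint h := (realPart y).2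
  have hsa' : IsSelfAdjoint h' := (imaginaryPart y).2
  have him := character_im_eq_zero χ hsa
  have him' := character_im_eq_zero χ hsa'
  have hnorm : ‖h‖ ≤ ‖y‖ := realPart.norm_le y
  have hχh : χ h = (‖y‖ : ℂ) := by
    rw [← hχ, ← hy, map_add, map_smul, smul_eq_mul]
    have h1 : (χ h').re = 0 := by
      have h2 := congrArg im hχ
      rw [← hy, map_add, map_smul, smul_eq_mul] at h2
      simpa [him] using h2
    have h3 : χ h' = 0 := Complex.ext h1 him'
    rw [h3, mul_zero, add_zero]
  have hd : χ (S.deriv ξ h) = 0 := by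
    have h1 := S.character_deriv_eq_zero hcomm hreg hone ξ (nonneg_smul_one_sub hsa hnorm)
      (χ := χ) (by rw [map_sub, map_smul, map_one, hχh, smul_eq_mul, mul_one, sub_self])
    have h2 : S.deriv ξ 1 = 0 := by
      have h3 := S.deriv_mul hcomm hone ξ 1 1
      simpa using h3
    rw [map_sub, map_smul, h2, smul_zero, zero_sub, map_neg, neg_eq_zero] at h1
    exact h1
  have hd' := character_im_eq_zero χ (S.isSelfAdjoint_deriv hcomm hone ξ hsa')
  have hre : (χ (y + (t : ℂ) • S.deriv ξ y)).re = ‖y‖ := by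
    have h1 : χ (S.deriv ξ y) = I * χ (S.deriv ξ h') := by
      conv_lhs => rw [← hy]
      rw [map_add, map_smul, map_add, map_smul, hd, zero_add, smul_eq_mul]
    rw [map_add, map_smul, h1, hχ]
    simp [hd']
  exact hre.symm.trans_le ((re_le_norm _).trans (norm_character_le χ _))

theorem norm_le_norm_add_smul_deriv (hcomm : T.IsCommutative) (hreg : T.IsRegular)
    (hone : T.OrderOne) (ξ : smoothDomain T.D) (x : T.A) (t : ℝ) :
    ‖x‖ ≤ ‖x + (t : ℂ) • S.deriv ξ x‖ := by
  by_cases hx : x = 0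
  · simp [hx]
  have hx0 : (‖x‖ : ℂ) ≠ 0 := by exact_mod_cast norm_ne_zero_iff.mpr hx
  have : Nontrivial H := by
    by_contra hH
    rw [not_nontrivial_iff_subsingleton] at hH
    exact hx (Subtype.ext (ContinuousLinearMap.ext fun v => Subsingleton.elim _ _))
  obtain ⟨χ, hχ⟩ := exists_character_norm_eq hcomm x
  set u : ℂ := (starRingEnd ℂ) (χ x) / ‖x‖ with hu
  have hu1 : ‖u‖ = 1 := by
    rw [hu, norm_div, RCLike.norm_conj, hχ, norm_real, norm_norm]
    exact div_self (norm_ne_zero_iff.mpr hx)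
  have hnu : ∀ z : T.A, ‖u • z‖ = ‖z‖ := fun z => by rw [norm_smul, hu1, one_mul]
  have hχu : χ (u • x) = (‖u • x‖ : ℂ) := by
    rw [hnu, map_smul, smul_eq_mul, hu, div_mul_eq_mul_div, conj_mul', hχ, sq,
      mul_div_cancel_right₀ _ hx0]
  have h1 := S.norm_le_norm_add_smul_deriv_of_apply_eq hcomm hreg hone ξ hχu t
  rwa [map_smul, smul_comm (t : ℂ) u, ← smul_add, hnu, hnu] at h1

end HermitianFinite

end SpectralTriple

end ConnesSpectral

end

theorem theorem5p1 {H : Type*} [NormedAddCommGroup H] [InnerProductSpace ℂ H] [CompleteSpace H]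
    (T : ConnesSpectral.SpectralTriple H) (hcomm : T.IsCommutative) (hreg : T.IsRegular)
    (hone : T.OrderOne) :
    -- `[D, h]` vanishes where `|h|` reaches its maximum
    (∀ h : T.A, IsSelfAdjoint h →
      ∀ χ : T.Spec, (∀ φ : T.Spec, ‖φ h‖ ≤ ‖χ h‖) →
      ∀ b : ℕ → T.A, (∃ C : ℝ, ∀ n, ‖b n‖ ≤ C) →
      (∀ U ∈ nhds χ, ∀ᶠ n in Filter.atTop, T.supp (b n) ⊆ U) →
      Filter.Tendsto (fun n => ‖T.d h * (b n : H →L[ℂ] H)‖) Filter.atTop (nhds 0)) ∧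
    -- the derivations `a ↦ i (ξ|[D, a] ξ)` are well defined and dissipative
    (∀ (S : T.HermitianFinite) (ξ : ConnesSpectral.smoothDomain T.D),
      ∃ δ : T.A →ₗ[ℂ] T.A,
        (∀ a : T.A, ∃ hmem : T.d a (ξ : H) ∈ ConnesSpectral.smoothDomain T.D,
          δ a = Complex.I • S.herm ξ ⟨T.d a (ξ : H), hmem⟩) ∧
        (∀ a b : T.A, δ (a * b) = δ a * b + a * δ b) ∧
        ∀ (x : T.A) (t : ℝ), ‖x‖ ≤ ‖x + (t : ℂ) • δ x‖) := by
  refine ⟨fun h hh χ hχ b ⟨C, hC⟩ hb =>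
    ConnesSpectral.SpectralTriple.tendsto_d_mul_of_isMax hcomm hreg hone hh hχ hC hb,
    fun S ξ => ⟨S.deriv ξ, fun a => ⟨S.d_mem_smoothDomain a ξ, rfl⟩,
      S.deriv_mul hcomm hone ξ, S.norm_le_norm_add_smul_deriv hcomm hreg hone ξ⟩⟩
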